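/- There is an algorithm (a fixed program for the word RAM) with the following properties. Its input is a connected, unweighted, undirected simple graph $G$ with $n \ge 2$ vertices, given in a read-only memory in the form of adjacency lists: the degree of each vertex and the head of its adjacency list can be accessed in constant time, and the list (a linked list of the neighbours, in any order) can be iterated through. The algorithm enumerates the edges of a spanning tree $T$ of $G$, that is, it emits each edge of $T$ exactly once and then halts. It does so - without preprocessing and with delay in $O(\overline{\Delta})$, where $\overline{\Delta} = \frac1n \sum_{v} \deg(v)$ is the average degree of $G$: there is a constant $C$, independent of $G$, such that the time before the first emission, the time between any two consecutive emissions, and the time between the last emission and halting are each at most $C\,\overline{\Delta}$; - with $\Theta(n)$ cells of lazy-initialized memory, that is, memory that can be reserved in blocks of any size in constant time and whose cells read $0$ until they are written to; - with space complexity $\Theta(n)$ in total, counting all reserved cells of working memory, lazy-initialized or not; memory that is not lazy-initialized has arbitrary initial contents. Here every instruction on machine words (arithmetic, bitwise operations, comparison, memory access, reserving a block of memory, emitting an edge) takes one unit of time, and the word size $w$ may be any number with $2^w \ge K(n+1)$, for a constant $K$ of the algorithm, such that the addresses occurring in the input fit into words (in particular, any word size $w \ge c\log n$ suffices for a suitable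 constant $c$, if the input is laid out in $O(n^2)$ cells). -/

import Mathlib

/-!  The word RAM, enumeration algorithms on it, and graphs given by adjacency lists.  -/

namespace WordRAM

/-- The binary operations on words that the machine performs in one step (all unsigned, and
modulo `2 ^ w` for word size `w`). -/
inductive BinOp where
  | add | sub | mul | div | mod | and | or | xor | shl | shr

/-- The value of a binary operation on `w`-bit words. -/
def BinOp.eval {w : ℕ} : BinOp → BitVec w → BitVec w → BitVec w
  | .add, x, y => x + y
  | .sub, x, y => x - y
  | .mul, x, y => x * y
  | .div, x, y => x / y
  | .mod, x, y => x % y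
  | .and, x, y => x &&& y
  | .or, x, y => x ||| y
  | .xor, x, y => x ^^^ y
  | .shl, x, y => x <<< y
  | .shr, x, y => x >>> y

/-- The instructions of the machine. `L` is the set of program labels; `next`, `yes` and `no` are
the labels where the computation goes on. The other arguments (except the literal `c`) are names
of registers: `d` receives a result, the others are read. -/
inductive Instr (L : Type) where
  /-- `d := c` -/
  | const (d c : ℕ) (next : L)
  /-- `d := a o b` -/
  | op (o : BinOp) (d a b : ℕ) (next : L)
  /-- go to `yes` if `a = b`, otherwise to `no` -/
  | ifEq (a b : ℕ) (yes no : L)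
  /-- go to `yes` if `a < b`, otherwise to `no` -/
  | ifLt (a b : ℕ) (yes no : L)
  /-- `d :=` the cell of the read-only input whose address is in `a` -/
  | read (d a : ℕ) (next : L)
  /-- `d :=` the cell of the working memory whose address is in `a` -/
  | load (d a : ℕ) (next : L)
  /-- write `b` into the cell of the working memory whose address is in `a` -/
  | store (a b : ℕ) (next : L)
  /-- reserve as many uninitialized cells as the number in `k` says; `d :=` the first address -/
  | alloc (d k : ℕ) (next : L)
  /-- reserve as many lazy-initialized cells (they all read `0` until they are written to) as the
  number in `k` says; `d :=` the first address -/
  | lazyAlloc (d k : ℕ) (next : L)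
  /-- emit the pair of the words in `a` and `b` -/
  | emit (a b : ℕ) (next : L)
  /-- stop -/
  | halt

/-- A program: an instruction for each of finitely many labels. In particular it mentions only
finitely many registers. -/
structure Program where
  Label : Type
  finite_label : Finite Label
  start : Label
  code : Label → Instr Label

/-- A read-only input, or the contents of the working memory: `2 ^ w` cells, each holding a word. -/
abbrev Memory (w : ℕ) : Type := BitVec w → BitVec w

/-- The configurations of a program on a machine with word size `w`. -/
structure Config (P : Program) (w : ℕ) where
  /-- the label of the instruction that is to be executed next -/
  label : P.Label
  reg : ℕ → BitVec w
  mem : Memory w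
  /-- the number of cells of the working memory reserved so far: these are the cells with an
  address below `space` -/
  space : ℕ
  /-- how many of the reserved cells were reserved as lazy-initialized memory -/
  lazySpace : ℕ
  /-- the number of instructions executed so far -/
  time : ℕ
  /-- everything emitted so far, in the order of emission, with the time of emission -/
  out : List (ℕ × BitVec w × BitVec w)

namespace Config

variable {P : Program} {w : ℕ}

/-- The starting configuration. Nothing is reserved, and the working memory holds arbitrary
contents `M`. -/
def initial (P : Program) {w : ℕ} (M : Memory w) : Config P w where
  label := P.start
  reg := fun _ => 0
  mem := M
  space := 0
  lazySpace := 0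
  time := 0
  out := []

/-- Continue at label `l`, one time unit later. -/
def goto (s : Config P w) (l : P.Label) : Config P w :=
  { s with label := l, time := s.time + 1 }

/-- Put `x` into register `d`. -/
def setReg (s : Config P w) (d : ℕ) (x : BitVec w) : Config P w :=
  { s with reg := Function.update s.reg d x }

/-- Execute one instruction, on input `I`. There is no next configuration if the instruction is
`halt`, if it accesses a cell of the working memory that is not reserved, or if it tries to
reserve more cells than there are. Every instruction takes one unit of time. -/
def step (I : Memory w) (s : Config P w) : Option (Config P w) :=
  match P.code s.label with
  | .const d c l => some ((s.setReg d (BitVec.ofNat w c)).goto l)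
  | .op o d a b l => some ((s.setReg d (o.eval (s.reg a) (s.reg b))).goto l)
  | .ifEq a b yes no => some (if s.reg a = s.reg b then s.goto yes else s.goto no)
  | .ifLt a b yes no => some (if s.reg a < s.reg b then s.goto yes else s.goto no)
  | .read d a l => some ((s.setReg d (I (s.reg a))).goto l)
  | .load d a l =>
      if (s.reg a).toNat < s.space then some ((s.setReg d (s.mem (s.reg a))).goto l) else none
  | .store a b l =>
      if (s.reg a).toNat < s.space then
        some ({ s with mem := Function.update s.mem (s.reg a) (s.reg b) }.goto l)
      else none
  | .alloc d k l =>
      if s.space + (s.reg k).toNat ≤ 2 ^ w then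
        some ({ s.setReg d (BitVec.ofNat w s.space) with
          space := s.space + (s.reg k).toNat }.goto l)
      else none
  | .lazyAlloc d k l =>
      if s.space + (s.reg k).toNat ≤ 2 ^ w then
        some ({ s.setReg d (BitVec.ofNat w s.space) with
          mem := fun x =>
            if s.space ≤ x.toNat ∧ x.toNat < s.space + (s.reg k).toNat then 0 else s.mem x
          space := s.space + (s.reg k).toNat
          lazySpace := s.lazySpace + (s.reg k).toNat }.goto l)
      else none
  | .emit a b l =>
      some ({ s with out := s.out ++ [(s.time + 1, s.reg a, s.reg b)] }.goto l)
  | .halt => none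

/-- The times of the emissions. -/
def emitTimes (s : Config P w) : List ℕ := s.out.map fun o => o.1

/-- The emitted pairs, read as undirected edges between numbers. -/
def emitEdges (s : Config P w) : List (Sym2 ℕ) := s.out.map fun o => s(o.2.1.toNat, o.2.2.toNat)

/-- Each of the following takes at most `D` units of time: the computation from the start up to
the first emission, the computation between two consecutive emissions, and the computation from
the last emission up to the end of the run, which is `s`. So there is no preprocessing, and the
delay is at most `D`. -/
def DelayAtMost (s : Config P w) (D : ℝ) : Prop :=
  List.IsChain (fun t t' : ℕ => (t' : ℝ) - (t : ℝ) ≤ D) (0 :: s.emitTimes ++ [s.time])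

end Config

/-- Started on input `I` with working memory contents `M`, the program `P` halts in
configuration `s`. -/
def Program.HaltsIn (P : Program) {w : ℕ} (I M : Memory w) (s : Config P w) : Prop :=
  Relation.ReflTransGen (fun a b : Config P w => a.step I = some b) (Config.initial P M) s ∧
    P.code s.label = Instr.halt

/-- The input holds at address `p` a linked list with the entries `l`. A nonempty list is given by
the address (never `0`) of a cell with its first entry; the cell behind it holds the address of the
rest of the list. The address `0` stands for the empty list. -/
def IsLinkedList {w n : ℕ} (I : Memory w) : BitVec w → List (Fin n) → Prop
  | p, [] => p = 0
  | p, v :: l => p ≠ 0 ∧ (I p).toNat = v.val ∧ IsLinkedList I (I (p + 1)) l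

/-- The input `I` represents the graph `G` on the vertices `0, …, n - 1` in the form of adjacency
lists. Cell `0` holds `n`, cell `2 v + 1` the degree of `v` (the length of the adjacency list of
`v`), and cell `2 v + 2` the address of the adjacency list of `v`, a linked list that contains
each neighbour of `v` once, in any order. -/
def Represents {w n : ℕ} (I : Memory w) (G : SimpleGraph (Fin n)) : Prop :=
  2 * n + 1 ≤ 2 ^ w ∧ (I 0).toNat = n ∧
    ∃ adj : Fin n → List (Fin n), ∀ v : Fin n,
      (adj v).Nodup ∧ (∀ u : Fin n, u ∈ adj v ↔ G.Adj v u) ∧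
      (I (BitVec.ofNat w (2 * v.val + 1))).toNat = (adj v).length ∧
      IsLinkedList I (I (BitVec.ofNat w (2 * v.val + 2))) (adj v)

/-- The list `es` consists of the edges of some spanning tree of `G`, each exactly once. -/
def ListsSpanningTree {n : ℕ} (G : SimpleGraph (Fin n)) (es : List (Sym2 ℕ)) : Prop :=
  es.Nodup ∧ ∃ T : SimpleGraph (Fin n), T ≤ G ∧ T.IsTree ∧
    {e : Sym2 ℕ | e ∈ es} = Sym2.map Fin.val '' T.edgeSet

/-- The average degree of a graph. -/
noncomputable def avgDegree {n : ℕ} (G : SimpleGraph (Fin n)) [DecidableRel G.Adj] : ℝ :=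
  (∑ v : Fin n, (G.degree v : ℝ)) / (n : ℝ)

end WordRAM

/-!
Let `q` be the integral part of the average degree. A search through the graph takes time
proportional to `n (q + 1)`, but it may go without a new tree edge for a long time, for instance
inside a dense part of the graph. The delay is kept small by a buffer of edges that are known to
belong to the final tree before the search starts.

*First forest.* The vertices are visited in the order of their numbers. A vertex `v` without a label
is joined to its first neighbour `u`, and both get a common label: that of `u` if `u` has one,
otherwise a new one. As `v` was isolated, this closes no cycle, and the labels are exactly the names
of the components (`Labels.concat`, `Labels.concat_fresh`). Every edge labels at most two vertices,
so at least `v / 2` edges are known after `v` vertices (`Labels.le_two_mul_length`), and the machine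
emits one of them every four vertices only. When all vertices are labelled, at least `n / 4` edges
are left. Meanwhile the degrees are summed up as a quotient by `n` and a remainder: the sum itself
may not fit into a word.

*Search.* The machine searches `G` from vertex `0` with a queue of vertices. At a vertex `y`, a
neighbour `x` in a component not seen before gives a new tree edge, and `x` enters the queue; a
neighbour in the component of `y` enters the queue if it is not yet there. At the end the new edges
together with the first forest are a spanning tree (`Search.connected`, `IsForest.concat`). The
number of elementary steps is less than `(q + 2) n`, and one edge is emitted every `4 (q + 2)`
steps, so the `n / 4` edges of the buffer suffice (`Searching.runs`). What then remains in the
buffer is emitted at once (`Timely.runs_flush`).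

The program is a list of 88 instructions. `Ensures` is its Hoare logic: configurations are described
by natural numbers instead of words, and there is one rule per instruction. `Runs` specializes this
to the normal form of the registers, and the lemmas on `Runs` describe the straight-line blocks of
the program. The invariants of the two main phases are `Growing` and `Searching`; the bound on the
delay is carried along by `Timely`.
-/

namespace WordRAM

/-! ### The program and its symbolic execution -/

/-- The instructions of the program. Registers `0` and `1` hold these numbers, `2` holds `n`, and
`3`, …, `7` hold the addresses `n + 1`, …, `5 (n + 1)` of blocks of `n + 1` cells each. The blocks
hold: the labels of the vertices (block 0; the label `0` means none), the labels of the components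
that the search has reached (1), the vertices that the search has reached (2), the queue of the
search (3), and the first and second ends of the edges found (4, 5). Registers `8`, …, `19` hold the
fields `v`, …, `qt` of `State`, and `20`, …, `23` are scratch registers. -/
def listing : List (Instr (Fin 88)) := [
  -- 0: the constant one, the number of vertices, the addresses of the blocks, their reservation
  .const 1 1 1,
  .read 2 0 2,
  .op .add 3 2 1 3,
  .op .add 4 3 3 4,
  .op .add 5 4 3 5,
  .op .add 6 5 3 6,
  .op .add 7 6 3 7,
  .op .add 20 7 3 8,
  .lazyAlloc 20 20 9,
  .const 14 4 10,
  -- 10: head of the loop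
  .ifLt 8 2 12 11,
  .ifEq 19 0 35 45,
  -- 12: the degree of `v` is added to the running quotient and remainder
  .op .add 20 8 8 13,
  .op .add 20 20 1 14,
  .read 22 20 15,
  .op .add 10 10 22 16,
  .ifLt 10 2 19 17,
  .op .sub 10 10 2 18,
  .op .add 9 9 1 19,
  -- 19: an unlabelled `v` is joined to its first neighbour
  .load 22 8 20,
  .ifEq 22 0 21 34,
  .op .add 20 20 1 22,
  .read 20 20 23,
  .read 21 20 24,
  .load 22 21 25,
  .ifEq 22 0 26 28,
  .op .add 22 21 1 27,
  .store 21 22 28,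
  .store 8 22 29,
  .op .add 20 6 12 30,
  .store 20 8 31,
  .op .add 20 7 12 32,
  .store 20 21 33,
  .op .add 12 12 1 34,
  .op .add 8 8 1 77,
  -- 35: preparation of the search from vertex `0`
  .op .add 14 9 1 36,
  .op .add 14 14 1 37,
  .op .add 14 14 14 38,
  .op .add 14 14 14 39,
  .load 22 0 40,
  .op .add 20 3 22 41,
  .store 20 1 42,
  .store 4 1 43,
  .store 5 0 44,
  .const 19 1 10,
  -- 45: the next neighbour `x` of `y`
  .ifEq 15 0 68 46,
  .read 21 15 47,
  .op .add 15 15 1 48,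
  .read 15 15 49,
  .load 22 21 50,
  .op .add 20 3 22 51,
  .load 23 20 52,
  .ifEq 23 0 53 59,
  .store 20 1 54,
  .op .add 20 6 12 55,
  .store 20 16 56,
  .op .add 20 7 12 57,
  .store 20 21 58,
  .op .add 12 12 1 63,
  .ifEq 22 17 60 77,
  .op .add 20 4 21 61,
  .load 23 20 62,
  .ifEq 23 0 63 77,
  -- 63: `x` enters the queue of the search
  .op .add 20 4 21 64,
  .store 20 1 65,
  .op .add 20 5 19 66,
  .store 20 21 67,
  .op .add 19 19 1 77,
  -- 68: the next vertex `y` leaves the queue of the search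
  .ifLt 18 19 69 79,
  .op .add 20 5 18 70,
  .load 16 20 71,
  .op .add 18 18 1 72,
  .load 17 16 73,
  .op .add 20 16 16 74,
  .op .add 20 20 1 75,
  .op .add 20 20 1 76,
  .read 15 20 77,
  -- 77: the clock
  .op .add 13 13 1 78,
  .ifLt 13 14 10 80,
  .ifEq 11 12 87 80,
  -- 80: an edge leaves the buffer
  .const 13 0 81,
  .op .add 20 6 11 82,
  .load 21 20 83,
  .op .add 20 7 11 84,
  .load 22 20 85,
  .emit 21 22 86,
  .op .add 11 11 1 10,
  .halt]

/-- The instruction at a label. -/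
def code (l : Fin 88) : Instr (Fin 88) := listing.getD l .halt

/-- The program that enumerates the edges of a spanning tree. -/
def treeProgram : Program where
  Label := Fin 88
  finite_label := inferInstance
  start := 0
  code := code

/-- The configuration `s` is at label `l`, and as natural numbers its registers are the entries of
`ρ` (and `0` beyond), its memory is `μ`, and its output is `o`;
`sp`, `lz` and `t` are the space, the lazy-initialized space and the time. -/
structure Shows {w : ℕ} (s : Config treeProgram w) (l : Fin 88) (ρ : List ℕ) (μ : ℕ → ℕ)
    (sp lz t : ℕ) (o : List (ℕ × ℕ × ℕ)) : Prop where
  label : s.label = l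
  reg : ∀ i, (s.reg i).toNat = ρ.getD i 0
  mem : ∀ i < 2 ^ w, (s.mem (BitVec.ofNat w i)).toNat = μ i
  space : s.space = sp
  lazySpace : s.lazySpace = lz
  time : s.time = t
  out : s.out.map (fun e => (e.1, e.2.1.toNat, e.2.2.toNat)) = o

/-- From every configuration that the other arguments describe, the program reaches one that
satisfies `Q`. -/
def Ensures {w : ℕ} (I : Memory w) (Q : Config treeProgram w → Prop) (l : Fin 88) (ρ : List ℕ)
    (μ : ℕ → ℕ) (sp lz t : ℕ) (o : List (ℕ × ℕ × ℕ)) : Prop :=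
  ∀ s, Shows s l ρ μ sp lz t o →
    ∃ s', Relation.ReflTransGen (fun a b : Config treeProgram w => a.step I = some b) s s' ∧ Q s'

section rules

variable {w : ℕ} {I : Memory w} {Q : Config treeProgram w → Prop} {l l' l'' : Fin 88}
  {ρ : List ℕ} {μ : ℕ → ℕ} {sp lz t : ℕ} {o : List (ℕ × ℕ × ℕ)} {d a b : ℕ}

theorem Ensures.of_step {l₁ : Fin 88} {ρ₁ μ₁ sp₁ lz₁ t₁ o₁}
    (h : ∀ s : Config treeProgram w, Shows s l ρ μ sp lz t o →
      ∃ s', s.step I = some s' ∧ Shows s' l₁ ρ₁ μ₁ sp₁ lz₁ t₁ o₁)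
    (h₁ : Ensures I Q l₁ ρ₁ μ₁ sp₁ lz₁ t₁ o₁) : Ensures I Q l ρ μ sp lz t o := by
  intro s hs
  obtain ⟨s₁, hs₁, hv⟩ := h s hs
  obtain ⟨s', hs', hq⟩ := h₁ s₁ hv
  exact ⟨s', .head hs₁ hs', hq⟩

/-- The effect of an instruction that puts `x` into register `d`. -/
theorem Shows.set {s : Config treeProgram w} (hs : Shows s l ρ μ sp lz t o) (hd : d < ρ.length)
    {x : BitVec w} {z : ℕ} (hx : x.toNat = z) :
    Shows ((s.setReg d x).goto l') l' (ρ.set d z) μ sp lz (t + 1) o := by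
  refine ⟨rfl, fun i => ?_, hs.mem, hs.space, hs.lazySpace, congrArg (· + 1) hs.time, hs.out⟩
  by_cases h : i = d
  · subst h; simp [Config.goto, Config.setReg, hx, hd]
  · simp [Config.goto, Config.setReg, h, hs.reg i, List.getElem?_set_ne (Ne.symm h)]

theorem Shows.cell {s : Config treeProgram w} (hs : Shows s l ρ μ sp lz t o) (x : BitVec w) :
    (s.mem x).toNat = μ x.toNat := by
  rw [← hs.mem x.toNat x.isLt, BitVec.ofNat_toNat, BitVec.setWidth_eq]

theorem step_of_code {s : Config treeProgram w} (hs : Shows s l ρ μ sp lz t o)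
    {i : Instr (Fin 88)} (hc : code l = i) : treeProgram.code s.label = i := by
  rw [hs.label]; exact hc

theorem Ensures.const {c : ℕ} (hc : code l = .const d c l') (hd : d < ρ.length) (hlt : c < 2 ^ w)
    (h : Ensures I Q l' (ρ.set d c) μ sp lz (t + 1) o) : Ensures I Q l ρ μ sp lz t o :=
  h.of_step fun s hs => ⟨_, by rw [Config.step, step_of_code hs hc],
    hs.set hd (by rw [BitVec.toNat_ofNat, Nat.mod_eq_of_lt hlt])⟩

/-- Addition with overflow; the address after the last cell of the input is `0`. -/
theorem Ensures.add_mod (hc : code l = .op .add d a b l') (hd : d < ρ.length)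
    (h : Ensures I Q l' (ρ.set d ((ρ.getD a 0 + ρ.getD b 0) % 2 ^ w)) μ sp lz (t + 1) o) :
    Ensures I Q l ρ μ sp lz t o :=
  h.of_step fun s hs => ⟨_, by rw [Config.step, step_of_code hs hc],
    hs.set hd (by rw [BinOp.eval, BitVec.toNat_add, hs.reg, hs.reg])⟩

theorem Ensures.add (hc : code l = .op .add d a b l') (hd : d < ρ.length)
    (hlt : ρ.getD a 0 + ρ.getD b 0 < 2 ^ w)
    (h : Ensures I Q l' (ρ.set d (ρ.getD a 0 + ρ.getD b 0)) μ sp lz (t + 1) o) :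
    Ensures I Q l ρ μ sp lz t o :=
  .add_mod hc hd (by rwa [Nat.mod_eq_of_lt hlt])

theorem Ensures.sub (hc : code l = .op .sub d a b l') (hd : d < ρ.length)
    (hle : ρ.getD b 0 ≤ ρ.getD a 0)
    (h : Ensures I Q l' (ρ.set d (ρ.getD a 0 - ρ.getD b 0)) μ sp lz (t + 1) o) :
    Ensures I Q l ρ μ sp lz t o :=
  h.of_step fun s hs => ⟨_, by rw [Config.step, step_of_code hs hc],
    hs.set hd (by
      rw [BinOp.eval, BitVec.toNat_sub_of_le (by rw [BitVec.le_def, hs.reg, hs.reg]; exact hle),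
        hs.reg, hs.reg])⟩

theorem Shows.goto {s : Config treeProgram w} (hs : Shows s l ρ μ sp lz t o) :
    Shows (s.goto l') l' ρ μ sp lz (t + 1) o :=
  ⟨rfl, hs.reg, hs.mem, hs.space, hs.lazySpace, congrArg (· + 1) hs.time, hs.out⟩

theorem Ensures.ifEq (hc : code l = .ifEq a b l' l'')
    (h : ρ.getD a 0 = ρ.getD b 0 → Ensures I Q l' ρ μ sp lz (t + 1) o)
    (h' : ρ.getD a 0 ≠ ρ.getD b 0 → Ensures I Q l'' ρ μ sp lz (t + 1) o) :
    Ensures I Q l ρ μ sp lz t o := by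
  by_cases hab : ρ.getD a 0 = ρ.getD b 0
  · refine (h hab).of_step fun s hs => ⟨s.goto l', ?_, hs.goto⟩
    rw [Config.step, step_of_code hs hc]
    simp only [BitVec.toNat_inj.symm, hs.reg, hab, if_true]
  · refine (h' hab).of_step fun s hs => ⟨s.goto l'', ?_, hs.goto⟩
    rw [Config.step, step_of_code hs hc]
    simp only [BitVec.toNat_inj.symm, hs.reg, hab, if_false]

theorem Ensures.ifLt (hc : code l = .ifLt a b l' l'')
    (h : ρ.getD a 0 < ρ.getD b 0 → Ensures I Q l' ρ μ sp lz (t + 1) o)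
    (h' : ¬ρ.getD a 0 < ρ.getD b 0 → Ensures I Q l'' ρ μ sp lz (t + 1) o) :
    Ensures I Q l ρ μ sp lz t o := by
  by_cases hab : ρ.getD a 0 < ρ.getD b 0
  · refine (h hab).of_step fun s hs => ⟨s.goto l', ?_, hs.goto⟩
    rw [Config.step, step_of_code hs hc]
    simp only [BitVec.lt_def, hs.reg, hab, if_true]
  · refine (h' hab).of_step fun s hs => ⟨s.goto l'', ?_, hs.goto⟩
    rw [Config.step, step_of_code hs hc]
    simp only [BitVec.lt_def, hs.reg, hab, if_false]

theorem Ensures.read (hc : code l = .read d a l') (hd : d < ρ.length)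
    (h : Ensures I Q l' (ρ.set d (I (BitVec.ofNat w (ρ.getD a 0))).toNat) μ sp lz (t + 1) o) :
    Ensures I Q l ρ μ sp lz t o :=
  h.of_step fun s hs => ⟨_, by rw [Config.step, step_of_code hs hc],
    hs.set hd (by rw [← hs.reg, BitVec.ofNat_toNat, BitVec.setWidth_eq])⟩

theorem Ensures.load (hc : code l = .load d a l') (hd : d < ρ.length) (ha : ρ.getD a 0 < sp)
    (h : Ensures I Q l' (ρ.set d (μ (ρ.getD a 0))) μ sp lz (t + 1) o) :
    Ensures I Q l ρ μ sp lz t o :=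
  h.of_step fun s hs => ⟨_, by
    rw [Config.step, step_of_code hs hc]; simp only; rw [if_pos]; rwa [hs.reg, hs.space],
    hs.set hd (by rw [hs.cell, hs.reg])⟩

theorem Ensures.store (hc : code l = .store a b l') (ha : ρ.getD a 0 < sp)
    (h : Ensures I Q l' ρ (Function.update μ (ρ.getD a 0) (ρ.getD b 0)) sp lz (t + 1) o) :
    Ensures I Q l ρ μ sp lz t o :=
  h.of_step fun s hs => ⟨_, by
    rw [Config.step, step_of_code hs hc]; simp only; rw [if_pos]; rwa [hs.reg, hs.space], by
    refine ⟨rfl, hs.reg, fun i hi => ?_, hs.space, hs.lazySpace, congrArg (· + 1) hs.time, hs.out⟩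
    have hi' : (BitVec.ofNat w i).toNat = i := by rw [BitVec.toNat_ofNat, Nat.mod_eq_of_lt hi]
    simp only [Config.goto, Function.update_apply, ← hs.reg, ← BitVec.toNat_inj, hi']
    split_ifs
    · rfl
    · exact hs.mem i hi⟩

/-- The first reservation: the block starts at address `0`. -/
theorem Ensures.lazyAlloc (hc : code l = .lazyAlloc d a l') (hd : d < ρ.length)
    (ha : ρ.getD a 0 ≤ 2 ^ w)
    (h : Ensures I Q l' (ρ.set d 0) (fun i => if i < ρ.getD a 0 then 0 else μ i)
      (ρ.getD a 0) (ρ.getD a 0) (t + 1) o) :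
    Ensures I Q l ρ μ 0 0 t o :=
  h.of_step fun s hs => ⟨_, by
    rw [Config.step, step_of_code hs hc]; simp only; rw [if_pos]
    rwa [hs.reg, hs.space, Nat.zero_add], by
    have := hs.set (l' := l') (x := BitVec.ofNat w s.space) (z := 0) hd (by simp [hs.space])
    refine ⟨rfl, this.reg, fun i hi => ?_, ?_, ?_, this.time, hs.out⟩
    · have hi' : (BitVec.ofNat w i).toNat = i := by rw [BitVec.toNat_ofNat, Nat.mod_eq_of_lt hi]
      simp only [Config.goto, hi', hs.reg, hs.space, Nat.zero_le, true_and, Nat.zero_add]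
      split_ifs
      · simp
      · exact hs.mem i hi
    · simp [Config.goto, hs.reg, hs.space]
    · simp [Config.goto, hs.reg, hs.lazySpace]⟩

theorem Ensures.emit (hc : code l = .emit a b l')
    (h : Ensures I Q l' ρ μ sp lz (t + 1) (o ++ [(t + 1, ρ.getD a 0, ρ.getD b 0)])) :
    Ensures I Q l ρ μ sp lz t o :=
  h.of_step fun s hs => ⟨_, by rw [Config.step, step_of_code hs hc], by
    refine ⟨rfl, hs.reg, hs.mem, hs.space, hs.lazySpace, congrArg (· + 1) hs.time, ?_⟩
    simp only [Config.goto, List.map_append, hs.out, List.map_cons, List.map_nil, hs.time, hs.reg]⟩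

theorem Ensures.halt (h : ∀ s, Shows s l ρ μ sp lz t o → Q s) : Ensures I Q l ρ μ sp lz t o :=
  fun s hs => ⟨s, .refl, h s hs⟩

end rules

/-! ### What the blocks of the program do -/

/-- What matters of a configuration between blocks of the program: registers `8` to `19`, the
memory, the time and the output. -/
structure State where
  /-- the next vertex of the first phase -/
  v : ℕ
  /-- the sum of the degrees of the vertices below `v` is `q * n + r` -/
  q : ℕ
  r : ℕ
  /-- the number of edges emitted so far -/
  hd : ℕ
  /-- the number of edges found so far -/
  tl : ℕ
  /-- the number of loop iterations since the last emission -/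
  ctr : ℕ
  /-- the number of loop iterations between emissions -/
  B : ℕ
  /-- the address of the rest of the adjacency list that is being read -/
  p : ℕ
  /-- the vertex whose adjacency list is being read -/
  y : ℕ
  /-- the label of `y` -/
  c : ℕ
  /-- the number of vertices that have left the queue of the search -/
  qh : ℕ
  /-- the number of vertices that have entered the queue of the search -/
  qt : ℕ
  mem : ℕ → ℕ
  time : ℕ
  out : List (ℕ × ℕ × ℕ)

/-- All registers, where `t`, `u`, `d`, `e` are the contents of the scratch registers. -/
def State.regs (σ : State) (n t u d e : ℕ) : List ℕ :=
  [0, 1, n, n + 1, 2 * (n + 1), 3 * (n + 1), 4 * (n + 1), 5 * (n + 1), σ.v, σ.q, σ.r, σ.hd, σ.tl,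
    σ.ctr, σ.B, σ.p, σ.y, σ.c, σ.qh, σ.qt, t, u, d, e]

/-- From label `l` and state `σ`, whatever the scratch registers hold, the program reaches a
configuration that satisfies `Q`. -/
def Runs {w : ℕ} (I : Memory w) (Q : Config treeProgram w → Prop) (n : ℕ) (l : Fin 88)
    (σ : State) : Prop :=
  ∀ t u d e, Ensures I Q l (σ.regs n t u d e) σ.mem (6 * (n + 1)) (6 * (n + 1)) σ.time σ.out

section blocks

variable {w : ℕ} {I : Memory w} {Q : Config treeProgram w → Prop} {n : ℕ} {σ : State}

/-- Label `77`, where every iteration of the main loop ends: the clock ticks. -/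
theorem Runs.clock (hlt : σ.ctr + 1 < 2 ^ w)
    (h : σ.ctr + 1 < σ.B → Runs I Q n 10 { σ with ctr := σ.ctr + 1, time := σ.time + 2 })
    (h' : ¬σ.ctr + 1 < σ.B → Runs I Q n 80 { σ with ctr := σ.ctr + 1, time := σ.time + 2 }) :
    Runs I Q n 77 σ := by
  intro t u d e
  refine .add rfl (by simp [State.regs]) hlt ?_
  refine .ifLt rfl (fun hc => ?_) (fun hc => ?_)
  · exact h hc t u d e
  · exact h' hc t u d e

/-- Label `80`: the next edge of the buffer is emitted, and the clock is set to `0`. -/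
theorem Runs.pop (hW : 7 * (n + 1) ≤ 2 ^ w) (hhd : σ.hd ≤ n)
    (h : Runs I Q n 10 { σ with
      ctr := 0, hd := σ.hd + 1, time := σ.time + 7
      out := σ.out ++ [(σ.time + 6, σ.mem (4 * (n + 1) + σ.hd), σ.mem (5 * (n + 1) + σ.hd))] }) :
    Runs I Q n 80 σ := by
  intro t u d e
  refine .const rfl (by simp [State.regs]) (by omega) ?_
  refine .add rfl (by simp [State.regs]) (by simp [State.regs]; omega) ?_
  refine .load rfl (by simp [State.regs]) (by simp [State.regs]; omega) ?_
  refine .add rfl (by simp [State.regs]) (by simp [State.regs]; omega) ?_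
  refine .load rfl (by simp [State.regs]) (by simp [State.regs]; omega) ?_
  refine .emit rfl ?_
  refine .add rfl (by simp [State.regs]) (by simp [State.regs]; omega) ?_
  exact h _ _ _ _

/-- Label `79`: the search is over, and the machine halts when the buffer is empty. -/
theorem Runs.flush (h : σ.hd = σ.tl → Runs I Q n 87 { σ with time := σ.time + 1 })
    (h' : σ.hd ≠ σ.tl → Runs I Q n 80 { σ with time := σ.time + 1 }) : Runs I Q n 79 σ := by
  intro t u d e
  exact .ifEq rfl (fun hc => h hc t u d e) (fun hc => h' hc t u d e)

/-- Label `10`, the head of the main loop. -/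
theorem Runs.head (h : σ.v < n → Runs I Q n 12 { σ with time := σ.time + 1 })
    (h' : ¬σ.v < n → Runs I Q n 11 { σ with time := σ.time + 1 }) : Runs I Q n 10 σ := by
  intro t u d e
  exact .ifLt rfl (fun hc => h hc t u d e) (fun hc => h' hc t u d e)

/-- Label `11`: if the queue is still unused, then the search has to be prepared. -/
theorem Runs.test (h : σ.qt = 0 → Runs I Q n 35 { σ with time := σ.time + 1 })
    (h' : σ.qt ≠ 0 → Runs I Q n 45 { σ with time := σ.time + 1 }) : Runs I Q n 11 σ := by
  intro t u d e
  exact .ifEq rfl (fun hc => h hc t u d e) (fun hc => h' hc t u d e)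

/-- Label `19`: if the vertex `v` has no label, then it is joined to its first neighbour `x` and
gets the label of `x`, after `x` itself has got a label if necessary. -/
theorem Ensures.pick (hW : 7 * (n + 1) ≤ 2 ^ w) (hv : σ.v < n) (htl : σ.tl ≤ n) {x : ℕ}
    (hx : (I (I (BitVec.ofNat w (2 * σ.v + 2)))).toNat = x) (hxn : x < n)
    (h : ∀ t', t' ≤ σ.time + 16 →
      (σ.mem σ.v ≠ 0 → Runs I Q n 77 { σ with v := σ.v + 1, time := t' }) ∧
      (σ.mem σ.v = 0 → σ.mem x ≠ 0 → Runs I Q n 77 { σ with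
        v := σ.v + 1, tl := σ.tl + 1, time := t'
        mem := Function.update (Function.update (Function.update σ.mem σ.v (σ.mem x))
          (4 * (n + 1) + σ.tl) σ.v) (5 * (n + 1) + σ.tl) x }) ∧
      (σ.mem σ.v = 0 → σ.mem x = 0 → Runs I Q n 77 { σ with
        v := σ.v + 1, tl := σ.tl + 1, time := t'
        mem := Function.update (Function.update (Function.update (Function.update σ.mem x (x + 1))
          σ.v (x + 1)) (4 * (n + 1) + σ.tl) σ.v) (5 * (n + 1) + σ.tl) x }))
    (u d e : ℕ) :
    Ensures I Q 19 (σ.regs n (2 * σ.v + 1) u d e) σ.mem (6 * (n + 1)) (6 * (n + 1)) σ.time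
      σ.out := by
  subst hx
  refine .load rfl (by simp [State.regs]) (by simp [State.regs]; omega) ?_
  refine .ifEq rfl (fun hc => ?_) (fun hc => ?_)
  · replace hc : σ.mem σ.v = 0 := hc
    refine .add rfl (by simp [State.regs]) (by simp [State.regs]; omega) ?_
    refine .read rfl (by simp [State.regs]) ?_
    refine .read rfl (by simp [State.regs]) ?_
    have hrd : (BitVec.ofNat w (I (BitVec.ofNat w (2 * σ.v + 2))).toNat) =
        I (BitVec.ofNat w (2 * σ.v + 2)) := by simp
    simp only [State.regs, List.set_cons_succ, List.set_cons_zero, List.getD_cons_succ,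
      List.getD_cons_zero, hrd]
    refine .load rfl (by simp) (by simp; omega) ?_
    refine .ifEq rfl (fun hx => ?_) (fun hx => ?_)
    · replace hx : σ.mem (I (I (BitVec.ofNat w (2 * σ.v + 2)))).toNat = 0 := hx
      refine .add rfl (by simp) (by simp; omega) ?_
      refine .store rfl (by simp; omega) ?_
      refine .store rfl (by simp; omega) ?_
      refine .add rfl (by simp) (by simp; omega) ?_
      refine .store rfl (by simp; omega) ?_
      refine .add rfl (by simp) (by simp; omega) ?_
      refine .store rfl (by simp; omega) ?_
      refine .add rfl (by simp) (by simp; omega) ?_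
      refine .add rfl (by simp) (by simp; omega) ?_
      exact (h _ (by omega)).2.2 hc hx _ _ _ _
    · replace hx : σ.mem (I (I (BitVec.ofNat w (2 * σ.v + 2)))).toNat ≠ 0 := hx
      refine .store rfl (by simp; omega) ?_
      refine .add rfl (by simp) (by simp; omega) ?_
      refine .store rfl (by simp; omega) ?_
      refine .add rfl (by simp) (by simp; omega) ?_
      refine .store rfl (by simp; omega) ?_
      refine .add rfl (by simp) (by simp; omega) ?_
      refine .add rfl (by simp) (by simp; omega) ?_
      exact (h _ (by omega)).2.1 hc hx _ _ _ _
  · replace hc : σ.mem σ.v ≠ 0 := hc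
    refine .add rfl (by simp [State.regs]) (by simp [State.regs]; omega) ?_
    exact (h _ (by omega)).1 hc _ _ _ _

/-- Label `12`: the degree of `v` is added to `q * n + r`. -/
theorem Runs.addDegree (hW : 7 * (n + 1) ≤ 2 ^ w) (hv : σ.v < n) (hr : σ.r < n) (hq : σ.q ≤ n)
    {g : ℕ} (hg : (I (BitVec.ofNat w (2 * σ.v + 1))).toNat = g) (hgn : g < n)
    (h : ∀ t' q' r', t' ≤ σ.time + 7 → q' * n + r' = σ.q * n + σ.r + g → r' < n →
      ∀ u d e, Ensures I Q 19 ({ σ with q := q', r := r', time := t' }.regs n (2 * σ.v + 1) u d e)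
        σ.mem (6 * (n + 1)) (6 * (n + 1)) t' σ.out) :
    Runs I Q n 12 σ := by
  intro t u d e
  subst hg
  refine .add rfl (by simp [State.regs]) (by simp [State.regs]; omega) ?_
  refine .add rfl (by simp [State.regs]) (by simp [State.regs]; omega) ?_
  refine .read rfl (by simp [State.regs]) ?_
  simp only [State.regs, List.set_cons_succ, List.set_cons_zero, List.getD_cons_succ,
      List.getD_cons_zero, ← two_mul]
  refine .add rfl (by simp) (by simp; omega) ?_
  refine .ifLt rfl (fun hc => ?_) (fun hc => ?_)
  · exact h _ σ.q _ (by simp) (by simp; omega) hc _ _ _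
  · replace hc : ¬ σ.r + (I (BitVec.ofNat w (2 * σ.v + 1))).toNat < n := hc
    refine .sub rfl (by simp) (by simp; omega) ?_
    refine .add rfl (by simp) (by simp; omega) ?_
    refine h _ (σ.q + 1) _ (by omega) ?_ ?_ _ _ _
    · simp [add_mul]; omega
    · simp; omega

/-- Label `35`: vertex `0` enters the queue of the search. -/
theorem Runs.prepare (hW : 7 * (n + 1) ≤ 2 ^ w) (hq : σ.q + 1 ≤ n) (hc : σ.mem 0 ≤ n)
    (h : Runs I Q n 10 { σ with
      B := 4 * (σ.q + 2), qt := 1, time := σ.time + 10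
      mem := Function.update (Function.update (Function.update σ.mem (n + 1 + σ.mem 0) 1)
        (2 * (n + 1)) 1) (3 * (n + 1)) 0 }) :
    Runs I Q n 35 σ := by
  intro t u d e
  refine .add rfl (by simp [State.regs]) (by simp [State.regs]; omega) ?_
  refine .add rfl (by simp [State.regs]) (by simp [State.regs]; omega) ?_
  refine .add rfl (by simp [State.regs]) (by simp [State.regs]; omega) ?_
  refine .add rfl (by simp [State.regs]) (by simp [State.regs]; omega) ?_
  simp only [State.regs, List.set_cons_succ, List.set_cons_zero, List.getD_cons_succ,
      List.getD_cons_zero]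
  rw [show σ.q + 1 + 1 + (σ.q + 1 + 1) + (σ.q + 1 + 1 + (σ.q + 1 + 1)) = 4 * (σ.q + 2) by ring]
  refine .load rfl (by simp) (by simp) ?_
  refine .add rfl (by simp) (by simp; omega) ?_
  refine .store rfl (by simp; omega) ?_
  refine .store rfl (by simp) ?_
  refine .store rfl (by simp) ?_
  refine .const rfl (by simp) (by omega) ?_
  exact h _ _ _ _

/-- Label `68`: the next vertex leaves the queue of the search, unless the queue is empty. -/
theorem Runs.take (hW : 7 * (n + 1) ≤ 2 ^ w) (hq : σ.qh ≤ n) {x : ℕ}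
    (hx : σ.qh < σ.qt → σ.mem (3 * (n + 1) + σ.qh) = x ∧ x < n)
    (h : ¬σ.qh < σ.qt → Runs I Q n 79 { σ with time := σ.time + 1 })
    (h' : σ.qh < σ.qt → Runs I Q n 77 { σ with
      y := x, c := σ.mem x, qh := σ.qh + 1, time := σ.time + 9
      p := (I (BitVec.ofNat w (2 * x + 2))).toNat }) :
    Runs I Q n 68 σ := by
  intro t u d e
  refine .ifLt rfl (fun hc => ?_) (fun hc => ?_)
  · obtain ⟨rfl, hxn⟩ := hx hc
    refine .add rfl (by simp [State.regs]) (by simp [State.regs]; omega) ?_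
    refine .load rfl (by simp [State.regs]) (by simp [State.regs]; omega) ?_
    refine .add rfl (by simp [State.regs]) (by simp [State.regs]; omega) ?_
    refine .load rfl (by simp [State.regs]) (by simp [State.regs]; omega) ?_
    refine .add rfl (by simp [State.regs]) (by simp [State.regs]; omega) ?_
    refine .add rfl (by simp [State.regs]) (by simp [State.regs]; omega) ?_
    refine .add rfl (by simp [State.regs]) (by simp [State.regs]; omega) ?_
    refine .read rfl (by simp [State.regs]) ?_
    simp only [State.regs, List.set_cons_succ, List.set_cons_zero, List.getD_cons_succ,
      List.getD_cons_zero, ← two_mul]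
    exact h' hc _ _ _ _
  · exact h hc _ _ _ _

/-- Label `63`: the vertex in register `21` enters the queue of the search. -/
theorem Ensures.enqueue (hW : 7 * (n + 1) ≤ 2 ^ w) {x : ℕ} (hx : x < n) (hq : σ.qt ≤ n)
    (h : Runs I Q n 77 { σ with
      qt := σ.qt + 1, time := σ.time + 5
      mem := Function.update (Function.update σ.mem (2 * (n + 1) + x) 1)
        (3 * (n + 1) + σ.qt) x }) (t d e : ℕ) :
    Ensures I Q 63 (σ.regs n t x d e) σ.mem (6 * (n + 1)) (6 * (n + 1)) σ.time σ.out := by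
  refine .add rfl (by simp [State.regs]) (by simp [State.regs]; omega) ?_
  refine .store rfl (by simp [State.regs]; omega) ?_
  refine .add rfl (by simp [State.regs]) (by simp [State.regs]; omega) ?_
  refine .store rfl (by simp [State.regs]; omega) ?_
  refine .add rfl (by simp [State.regs]) (by simp [State.regs]; omega) ?_
  exact h _ _ _ _

/-- Label `45`, when the adjacency list at `p` is not finished: its next entry `x` is treated. -/
theorem Runs.scan (hW : 7 * (n + 1) ≤ 2 ^ w) (hp : σ.p ≠ 0) (htl : σ.tl ≤ n) (hqt : σ.qt ≤ n)
    {x p' : ℕ} (hx : (I (BitVec.ofNat w σ.p)).toNat = x) (hxn : x < n)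
    (hp' : (I (BitVec.ofNat w σ.p + 1)).toNat = p') (hc : σ.mem x ≤ n)
    (h : ∀ t', t' ≤ σ.time + 19 →
      (σ.mem (n + 1 + σ.mem x) = 0 → Runs I Q n 77 { σ with
        p := p', tl := σ.tl + 1, qt := σ.qt + 1, time := t'
        mem := Function.update (Function.update
          (Function.update (Function.update (Function.update σ.mem (n + 1 + σ.mem x) 1)
            (4 * (n + 1) + σ.tl) σ.y) (5 * (n + 1) + σ.tl) x)
          (2 * (n + 1) + x) 1) (3 * (n + 1) + σ.qt) x }) ∧
      (σ.mem (n + 1 + σ.mem x) ≠ 0 → σ.mem x = σ.c → σ.mem (2 * (n + 1) + x) = 0 →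
        Runs I Q n 77 { σ with
          p := p', qt := σ.qt + 1, time := t'
          mem := Function.update (Function.update σ.mem (2 * (n + 1) + x) 1)
            (3 * (n + 1) + σ.qt) x }) ∧
      (σ.mem (n + 1 + σ.mem x) ≠ 0 → (σ.mem x = σ.c → σ.mem (2 * (n + 1) + x) ≠ 0) →
        Runs I Q n 77 { σ with p := p', time := t' })) :
    Runs I Q n 45 σ := by
  intro t u d e
  subst hx hp'
  refine .ifEq rfl (fun hc => absurd hc hp) (fun _ => ?_)
  refine .read rfl (by simp [State.regs]) ?_
  refine .add_mod rfl (by simp [State.regs]) ?_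
  refine .read rfl (by simp [State.regs]) ?_
  have hrd : BitVec.ofNat w ((σ.p + 1) % 2 ^ w) = BitVec.ofNat w σ.p + 1 := by
    apply BitVec.eq_of_toNat_eq
    simp [BitVec.toNat_add, BitVec.toNat_ofNat]
  simp only [State.regs, List.set_cons_succ, List.set_cons_zero, List.getD_cons_succ,
      List.getD_cons_zero, hrd]
  refine .load rfl (by simp) (by simp; omega) ?_
  refine .add rfl (by simp) (by simp; omega) ?_
  refine .load rfl (by simp) (by simp; omega) ?_
  refine .ifEq rfl (fun h0 => ?_) (fun h0 => ?_)
  · refine .store rfl (by simp; omega) ?_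
    refine .add rfl (by simp) (by simp; omega) ?_
    refine .store rfl (by simp; omega) ?_
    refine .add rfl (by simp) (by simp; omega) ?_
    refine .store rfl (by simp; omega) ?_
    refine .add rfl (by simp) (by simp; omega) ?_
    exact Ensures.enqueue (σ := { σ with
        p := _, tl := σ.tl + 1, time := _
        mem := Function.update (Function.update (Function.update σ.mem _ 1) _ σ.y) _ _ })
      hW hxn hqt ((h _ (by simp)).1 h0) _ _ _
  · refine .ifEq rfl (fun h1 => ?_) (fun h1 => ?_)
    · refine .add rfl (by simp) (by simp; omega) ?_
      refine .load rfl (by simp) (by simp; omega) ?_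
      refine .ifEq rfl (fun h2 => ?_) (fun h2 => ?_)
      · exact Ensures.enqueue (σ := { σ with p := _, time := σ.time + 12 })
          hW hxn hqt ((h (σ.time + 17) (by omega)).2.1 h0 h1 h2) _ _ _
      · exact (h (σ.time + 12) (by omega)).2.2 h0 (fun _ => h2) _ _ _ _
    · exact (h (σ.time + 9) (by omega)).2.2 h0 (fun h3 => absurd h3 h1) _ _ _ _

/-- Label `45`, when the adjacency list is finished. -/
theorem Runs.step_of_p_eq_zero (hp : σ.p = 0) (h : Runs I Q n 68 { σ with time := σ.time + 1 }) :
    Runs I Q n 45 σ := by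
  intro t u d e
  exact .ifEq rfl (fun _ => h t u d e) (fun hc => absurd hp hc)

end blocks

/-- The state after the initialization, except for the memory. -/
def State.initial : State where
  v := 0
  q := 0
  r := 0
  hd := 0
  tl := 0
  ctr := 0
  B := 4
  p := 0
  y := 0
  c := 0
  qh := 0
  qt := 0
  mem := fun _ => 0
  time := 10
  out := []

theorem exists_of_runs {w : ℕ} {I : Memory w} {Q : Config treeProgram w → Prop} {n : ℕ}
    (hW : 7 * (n + 1) ≤ 2 ^ w) (hn : (I 0).toNat = n) (M : Memory w)
    (h : ∀ μ : ℕ → ℕ, (∀ i < 6 * (n + 1), μ i = 0) →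
      Runs I Q n 10 { State.initial with mem := μ }) :
    ∃ s, Relation.ReflTransGen (fun a b : Config treeProgram w => a.step I = some b)
      (Config.initial treeProgram M) s ∧ Q s := by
  have key : Ensures I Q 0 (List.replicate 24 0) (fun i => (M (BitVec.ofNat w i)).toNat) 0 0 0
      [] := by
    refine .const rfl (by simp) (by omega) ?_
    refine .read rfl (by simp) ?_
    simp only [List.replicate, List.set_cons_succ, List.set_cons_zero,
      List.getD_cons_zero, show (I (BitVec.ofNat w 0)).toNat = n from hn]
    refine .add rfl (by simp) (by simp; omega) ?_
    refine .add rfl (by simp) (by simp; omega) ?_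
    refine .add rfl (by simp) (by simp; omega) ?_
    refine .add rfl (by simp) (by simp; omega) ?_
    refine .add rfl (by simp) (by simp; omega) ?_
    refine .add rfl (by simp) (by simp; omega) ?_
    refine .lazyAlloc rfl (by simp) (by simp; omega) ?_
    refine .const rfl (by simp) (by omega) ?_
    simp only [List.set_cons_succ, List.set_cons_zero, List.getD_cons_succ,
      List.getD_cons_zero]
    have hN : n + 1 + (n + 1) = 2 * (n + 1) ∧ 2 * (n + 1) + (n + 1) = 3 * (n + 1) ∧
      3 * (n + 1) + (n + 1) = 4 * (n + 1) ∧ 4 * (n + 1) + (n + 1) = 5 * (n + 1) ∧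
      5 * (n + 1) + (n + 1) = 6 * (n + 1) := by omega
    simp only [hN]
    exact h (fun i => if i < 6 * (n + 1) then 0 else (M (BitVec.ofNat w i)).toNat)
      (fun i hi => if_pos hi) 0 0 0 0
  refine key _ ⟨rfl, fun i => ?_, fun i _ => rfl, rfl, rfl, rfl, rfl⟩
  change (0 : BitVec w).toNat = (List.replicate 24 0).getD i 0
  rw [List.getD_eq_getElem?_getD, List.getElem?_replicate]
  split_ifs <;> simp

open Finset

/-! ### Forests, labelled components and the search for the remaining edges -/

section forest

variable {n : ℕ}

/-- The graph whose edges are listed in `es`. -/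
def graphOf (es : List (Fin n × Fin n)) : SimpleGraph (Fin n) :=
  SimpleGraph.fromEdgeSet {e | e ∈ es.map fun p => s(p.1, p.2)}

theorem graphOf_concat (es : List (Fin n × Fin n)) (a b : Fin n) :
    graphOf (es ++ [(a, b)]) = graphOf es ⊔ SimpleGraph.edge a b := by
  ext x z
  simp only [graphOf, SimpleGraph.sup_adj, SimpleGraph.adj_edge, SimpleGraph.fromEdgeSet_adj,
    List.map_append, List.map_cons, List.map_nil, Set.mem_ofPred_eq, List.mem_append,
    List.mem_singleton, eq_comm (a := s(a, b))]
  tauto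

theorem graphOf_concat_adj {es : List (Fin n × Fin n)} {a b x z : Fin n} :
    (graphOf (es ++ [(a, b)])).Adj x z ↔
      (graphOf es).Adj x z ∨ (x = a ∧ z = b ∨ x = b ∧ z = a) ∧ x ≠ z := by
  rw [graphOf_concat, SimpleGraph.sup_adj, SimpleGraph.edge_adj]

theorem reachable_apply_eq {G : SimpleGraph (Fin n)} {α : Type*} {f : Fin n → α}
    (hf : ∀ x z, G.Adj x z → f x = f z) {x z : Fin n} (h : G.Reachable x z) : f x = f z := by
  obtain ⟨p⟩ := h
  induction p with
  | nil => rfl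
  | cons hadj _ ih => exact (hf _ _ hadj).trans ih

/-- The list `es` consists of edges of `G`, each once, and they form a forest. -/
structure IsForest (G : SimpleGraph (Fin n)) (es : List (Fin n × Fin n)) : Prop where
  adj : ∀ p ∈ es, G.Adj p.1 p.2
  nodup : (es.map fun p => s(p.1, p.2)).Nodup
  acyclic : (graphOf es).IsAcyclic

variable {G : SimpleGraph (Fin n)} {es : List (Fin n × Fin n)}

theorem IsForest.nil : IsForest G [] where
  adj := by simp
  nodup := by simp
  acyclic := by simp [graphOf]

/-- An edge may be added to a forest if some invariant of the components tells its ends apart. -/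
theorem IsForest.concat (h : IsForest G es) {α : Type*} (f : Fin n → α)
    (hf : ∀ x z, (graphOf es).Adj x z → f x = f z) {a b : Fin n} (hab : f a ≠ f b)
    (hadj : G.Adj a b) : IsForest G (es ++ [(a, b)]) where
  adj := by
    intro p hp
    rcases List.mem_append.1 hp with hp | hp
    · exact h.adj p hp
    · rw [List.mem_singleton.1 hp]; exact hadj
  nodup := by
    rw [List.map_append, List.nodup_append]
    refine ⟨h.nodup, by simp, fun e he e' he' hee => hab (hf a b ?_)⟩
    rw [graphOf, SimpleGraph.fromEdgeSet_adj]
    simp only [List.map_cons, List.map_nil, List.mem_singleton] at he'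
    exact ⟨he' ▸ hee ▸ he, hadj.ne⟩
  acyclic := by
    rw [graphOf_concat]
    exact h.acyclic.sup_edge_of_not_reachable fun hr => hab (reachable_apply_eq hf hr)

theorem IsForest.edgeSet (h : IsForest G es) :
    (graphOf es).edgeSet = {e | e ∈ es.map fun p => s(p.1, p.2)} := by
  rw [graphOf, SimpleGraph.edgeSet_fromEdgeSet, sdiff_eq_left, Set.disjoint_left]
  rintro e he hd
  simp only [Set.mem_ofPred_eq, List.mem_map] at he
  obtain ⟨p, hp, rfl⟩ := he
  exact (h.adj p hp).ne hd

theorem IsForest.le (h : IsForest G es) : graphOf es ≤ G := by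
  rw [← SimpleGraph.edgeSet_subset_edgeSet, h.edgeSet]
  intro e he
  simp only [Set.mem_ofPred_eq, List.mem_map] at he
  obtain ⟨p, hp, rfl⟩ := he
  exact h.adj p hp

theorem IsForest.length_lt (h : IsForest G es) (hn : 0 < n) : es.length < n := by
  classical
  have : Nonempty (Fin n) := ⟨⟨0, hn⟩⟩
  obtain ⟨F, hle, -, hF⟩ :=
    (SimpleGraph.connected_top (V := Fin n)).exists_isTree_le_of_le_of_isAcyclic le_top h.acyclic
  have hcard := hF.card_edgeFinset
  rw [Fintype.card_fin] at hcard
  have hsub : (es.map fun p => s(p.1, p.2)).toFinset ⊆ F.edgeFinset := by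
    intro e he
    rw [SimpleGraph.mem_edgeFinset]
    apply SimpleGraph.edgeSet_mono hle
    rw [h.edgeSet]
    exact List.mem_toFinset.1 he
  have := card_le_card hsub
  rw [List.toFinset_card_of_nodup h.nodup, List.length_map] at this
  omega

theorem IsForest.listsSpanningTree (h : IsForest G es) (hc : (graphOf es).Connected) :
    ListsSpanningTree G (es.map fun p => s(p.1.val, p.2.val)) := by
  have hmap : (es.map fun p => s(p.1.val, p.2.val)) =
      (es.map fun p => s(p.1, p.2)).map (Sym2.map Fin.val) := by
    simp [List.map_map, Function.comp_def]
  refine ⟨?_, graphOf es, h.le, ⟨hc, h.acyclic⟩, ?_⟩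
  · rw [hmap]
    exact h.nodup.map (Sym2.map.injective Fin.val_injective)
  · rw [hmap, h.edgeSet]
    ext e
    simp only [Set.mem_ofPred_eq, List.mem_map, Set.mem_image]

/-- The labels `L` are constant on the components of the graph with edges `es`, an end of an edge
has a nonzero label, and vertices with the same nonzero label are connected. -/
structure Labels (es : List (Fin n × Fin n)) (L : Fin n → ℕ) : Prop where
  adj : ∀ x z, (graphOf es).Adj x z → L x = L z
  ne_zero : ∀ x z, (graphOf es).Adj x z → L x ≠ 0
  /-- the label `r + 1` names the component of the vertex `r` -/
  root : ∀ x, L x ≠ 0 → ∃ r : Fin n, L x = r + 1 ∧ L r = r + 1 ∧ (graphOf es).Reachable x r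
  card_le : #{x | L x ≠ 0} ≤ 2 * es.length

theorem Labels.nil : Labels (n := n) [] fun _ => 0 where
  adj := by simp
  ne_zero := by simp [graphOf]
  root := by simp
  card_le := by simp

variable {L : Fin n → ℕ}

theorem Labels.reachable (h : Labels es L) {x z : Fin n} (hx : L x ≠ 0) (hxz : L x = L z) :
    (graphOf es).Reachable x z := by
  obtain ⟨r, hr, -, hxr⟩ := h.root x hx
  obtain ⟨r', hr', -, hzr⟩ := h.root z (hxz ▸ hx)
  have : r = r' := Fin.ext (by omega)
  exact this ▸ hxr |>.trans hzr.symm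

theorem Labels.le (h : Labels es L) (x : Fin n) : L x ≤ n := by
  by_contra hx
  obtain ⟨r, hr, -⟩ := h.root x (by omega)
  omega

theorem Labels.isForest_concat (h : Labels es L) (hF : IsForest G es) {v u : Fin n} (hv : L v = 0)
    (hadj : G.Adj v u) : IsForest G (es ++ [(v, u)]) := by
  refine hF.concat (fun x => x = v) (fun x z hxz => ?_) ?_ hadj
  · have hx : x ≠ v := fun e => h.ne_zero x z hxz (e ▸ hv)
    have hz : z ≠ v := fun e => h.ne_zero z x hxz.symm (e ▸ hv)
    simp [hx, hz]
  · simp [hadj.ne']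

theorem reachable_concat {x z : Fin n} (h : (graphOf es).Reachable x z) (a b : Fin n) :
    (graphOf (es ++ [(a, b)])).Reachable x z :=
  h.mono (by rw [graphOf_concat]; exact le_sup_left)

theorem reachable_concat_self (a b : Fin n) : (graphOf (es ++ [(a, b)])).Reachable a b := by
  by_cases h : a = b
  · subst h; exact .refl _
  · exact (graphOf_concat_adj.2 (.inr ⟨.inl ⟨rfl, rfl⟩, h⟩)).reachable

/-- An unlabelled vertex is joined to a labelled one. -/
theorem Labels.concat (h : Labels es L) {v u : Fin n} (hv : L v = 0) (hu : L u ≠ 0) :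
    Labels (es ++ [(v, u)]) (Function.update L v (L u)) := by
  have hvu : u ≠ v := fun e => hu (e ▸ hv)
  have key : ∀ x z, (graphOf es).Adj x z → x ≠ v ∧ z ≠ v := fun x z hxz =>
    ⟨fun e => h.ne_zero x z hxz (e ▸ hv), fun e => h.ne_zero z x hxz.symm (e ▸ hv)⟩
  refine ⟨fun x z hxz => ?_, fun x z hxz => ?_, fun x hx => ?_, ?_⟩
  · rcases graphOf_concat_adj.1 hxz with hxz | ⟨⟨rfl, rfl⟩ | ⟨rfl, rfl⟩, -⟩
    · have := key x z hxz
      simp [this.1, this.2, h.adj x z hxz]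
    · simp [hvu]
    · simp [hvu]
  · rcases graphOf_concat_adj.1 hxz with hxz | ⟨⟨rfl, rfl⟩ | ⟨rfl, rfl⟩, -⟩
    · simpa [(key x z hxz).1] using h.ne_zero x z hxz
    · simpa using hu
    · simpa [hvu] using hu
  · obtain rfl | hxv := eq_or_ne x v
    · obtain ⟨r, hr, hrr, hur⟩ := h.root u hu
      have hrv : r ≠ x := fun e => by rw [e, hv] at hrr; omega
      exact ⟨r, by simp [hr], by simp [hrv, hrr],
        (reachable_concat_self x u).trans (reachable_concat hur _ _)⟩
    · rw [Function.update_of_ne hxv] at hx ⊢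
      obtain ⟨r, hr, hrr, hxr⟩ := h.root x hx
      have hrv : r ≠ v := fun e => by rw [e, hv] at hrr; omega
      exact ⟨r, hr, by simp [hrv, hrr], reachable_concat hxr _ _⟩
  · have : ({x | Function.update L v (L u) x ≠ 0} : Finset (Fin n)) ⊆
        insert v ({x | L x ≠ 0} : Finset (Fin n)) := by
      intro x
      obtain rfl | hxv := eq_or_ne x v <;> simp_all
    have h1 := (card_le_card this).trans (card_insert_le _ _)
    have h2 := h.card_le
    simp only [List.length_append, List.length_cons, List.length_nil]
    omega

/-- Two unlabelled vertices are joined. The label of the new component is unused because `u` is not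
the vertex that any other component is named after. -/
theorem Labels.concat_fresh (h : Labels es L) {v u : Fin n} (hv : L v = 0) (hu : L u = 0)
    (hne : v ≠ u) :
    Labels (es ++ [(v, u)]) (Function.update (Function.update L u (u + 1)) v (u + 1)) := by
  set L' := Function.update (Function.update L u (u + 1)) v (u + 1) with hL'
  have hLv : L' v = u + 1 := by simp [L']
  have hLu : L' u = u + 1 := by simp [L', hne.symm]
  have hLx : ∀ x, x ≠ v → x ≠ u → L' x = L x := fun x h1 h2 => by simp [L', h1, h2]
  have hnz : ∀ x, L x ≠ 0 → L' x = L x := fun x hx =>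
    hLx x (fun e => hx (e ▸ hv)) (fun e => hx (e ▸ hu))
  refine ⟨fun x z hxz => ?_, fun x z hxz => ?_, fun x hx => ?_, ?_⟩
  · rcases graphOf_concat_adj.1 hxz with hxz | ⟨⟨rfl, rfl⟩ | ⟨rfl, rfl⟩, -⟩
    · rw [hnz x (h.ne_zero x z hxz), hnz z (h.ne_zero z x hxz.symm), h.adj x z hxz]
    · rw [hLu, hLv]
    · rw [hLu, hLv]
  · rcases graphOf_concat_adj.1 hxz with hxz | ⟨⟨rfl, rfl⟩ | ⟨rfl, rfl⟩, -⟩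
    · rw [hnz x (h.ne_zero x z hxz)]; exact h.ne_zero x z hxz
    · rw [hLv]; omega
    · rw [hLu]; omega
  · by_cases hxv : x = v
    · exact ⟨u, hxv ▸ hLv, hLu, by rw [hxv]; exact reachable_concat_self v u⟩
    by_cases hxu : x = u
    · exact ⟨u, hxu ▸ hLu, hLu, hxu ▸ .refl _⟩
    rw [hLx x hxv hxu] at hx ⊢
    obtain ⟨r, hr, hrr, hxr⟩ := h.root x hx
    exact ⟨r, hr, by rw [hnz r (by omega), hrr], reachable_concat hxr _ _⟩
  · have : ({x | L' x ≠ 0} : Finset (Fin n)) ⊆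
        insert v (insert u ({x | L x ≠ 0} : Finset (Fin n))) := by
      intro x
      by_cases hxv : x = v
      · simp [hxv]
      by_cases hxu : x = u
      · simp [hxu]
      simp [hxv, hxu, hLx x hxv hxu]
    have h1 := (card_le_card this).trans (card_insert_le _ _)
    have h3 := card_insert_le u ({x | L x ≠ 0} : Finset (Fin n))
    have h2 := h.card_le
    simp only [List.length_append, List.length_cons, List.length_nil]
    omega

theorem Labels.le_two_mul_length (h : Labels es L) {v : ℕ} (hv : v ≤ n)
    (hL : ∀ x : Fin n, x < v → L x ≠ 0) : v ≤ 2 * es.length := by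
  refine le_trans ?_ h.card_le
  have : (univ.map (Fin.castLEEmb hv)) ⊆ ({x | L x ≠ 0} : Finset (Fin n)) := by
    intro x hx
    simp only [mem_map, mem_univ, true_and] at hx
    obtain ⟨i, rfl⟩ := hx
    simpa using hL _ i.isLt
  simpa using card_le_card this

end forest

section search

variable {n : ℕ}

/-- The invariant of the search from `root`. The graph `F` is the first forest, with component
labels `L`; `es` are the edges found, `vis` the labels of the components reached, `queue` all
vertices that have ever entered the queue, `k` the number of those that have left it, `y` the last
of them, and `rem` the neighbours of `y` still to be treated. -/
structure Search (G F : SimpleGraph (Fin n)) (L : Fin n → ℕ) (root : Fin n)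
    (es : List (Fin n × Fin n)) (vis : Finset ℕ) (queue : List (Fin n)) (k : ℕ) (y : Fin n)
    (rem : List (Fin n)) : Prop where
  isForest : IsForest G es
  le : F ≤ graphOf es
  adj : ∀ x z, (graphOf es).Adj x z → L x = L z ∨ L x ∈ vis ∧ L z ∈ vis
  reachable : ∀ x, L x ∈ vis → (graphOf es).Reachable root x
  nodup : queue.Nodup
  mem_vis : ∀ x ∈ queue, L x ∈ vis
  exists_mem : ∀ x, L x ∈ vis → ∃ z ∈ queue, L z = L x
  root_mem : root ∈ queue
  le_length : k ≤ queue.length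
  /-- a neighbour of a vertex that has left the queue has been treated or is still to be read -/
  closed : ∀ z ∈ queue.take k, ∀ x, G.Adj z x →
    z = y ∧ x ∈ rem ∨ L x ∈ vis ∧ (L x = L z → x ∈ queue)

/-- The graph `F` is a subgraph of `G`, and its components are the fibres of `L`. -/
structure IsQuotient (G F : SimpleGraph (Fin n)) (L : Fin n → ℕ) : Prop where
  le : F ≤ G
  adj : ∀ x z, F.Adj x z → L x = L z
  reachable : ∀ x z, L x = L z → F.Reachable x z

variable {G F : SimpleGraph (Fin n)} {L : Fin n → ℕ} {root : Fin n}
  {es : List (Fin n × Fin n)} {vis : Finset ℕ} {queue : List (Fin n)} {k : ℕ} {y : Fin n}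
  {rem : List (Fin n)}

theorem Search.start (hes : IsForest G es) (hL : IsQuotient G (graphOf es) L) (root y : Fin n) :
    Search G (graphOf es) L root es {L root} [root] 0 y [] where
  isForest := hes
  le := le_rfl
  adj x z h := .inl (hL.adj x z h)
  reachable x hx := hL.reachable _ _ (mem_singleton.1 hx).symm
  nodup := by simp
  mem_vis := by simp
  exists_mem x hx := ⟨root, by simp, (mem_singleton.1 hx).symm⟩
  root_mem := by simp
  le_length := by simp
  closed := by simp

/-- The neighbour `x` of `y` lies in a new component. -/
theorem Search.link {x : Fin n} (h : Search G F L root es vis queue k y (x :: rem))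
    (hL : IsQuotient G F L) (hy : L y ∈ vis) (hx : L x ∉ vis) (hadj : G.Adj y x) :
    Search G F L root (es ++ [(y, x)]) (insert (L x) vis) (queue ++ [x]) k y rem where
  isForest := by
    refine h.isForest.concat (fun z => L z ∈ vis) (fun a b hab => ?_) ?_ hadj
    · rcases h.adj a b hab with e | e
      · simp only [e]
      · simp only [e]
    · simp only [hx, hy]; simp
  le := h.le.trans (by rw [graphOf_concat]; exact le_sup_left)
  adj a b hab := by
    rcases graphOf_concat_adj.1 hab with hab | ⟨⟨rfl, rfl⟩ | ⟨rfl, rfl⟩, -⟩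
    · exact (h.adj a b hab).imp_right fun e =>
        ⟨mem_insert_of_mem e.1, mem_insert_of_mem e.2⟩
    · exact .inr ⟨mem_insert_of_mem hy, mem_insert_self _ _⟩
    · exact .inr ⟨mem_insert_self _ _, mem_insert_of_mem hy⟩
  reachable z hz := by
    rcases mem_insert.1 hz with hz | hz
    · exact (reachable_concat (h.reachable y hy) _ _).trans ((reachable_concat_self y x).trans
        (reachable_concat ((hL.reachable x z hz.symm).mono h.le) _ _))
    · exact reachable_concat (h.reachable z hz) _ _
  nodup := by
    rw [List.nodup_append]
    refine ⟨h.nodup, by simp, fun a ha b hb e => hx ?_⟩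
    rw [← List.mem_singleton.1 hb, ← e]
    exact h.mem_vis a ha
  mem_vis z hz := by
    rcases List.mem_append.1 hz with hz | hz
    · exact mem_insert_of_mem (h.mem_vis z hz)
    · rw [List.mem_singleton.1 hz]; exact mem_insert_self _ _
  exists_mem z hz := by
    rcases mem_insert.1 hz with hz | hz
    · exact ⟨x, by simp, hz.symm⟩
    · obtain ⟨z', h1, h2⟩ := h.exists_mem z hz
      exact ⟨z', by simp [h1], h2⟩
  root_mem := by simp [h.root_mem]
  le_length := h.le_length.trans (by simp)
  closed z hz a ha := by
    rw [List.take_append_of_le_length h.le_length] at hz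
    rcases h.closed z hz a ha with ⟨rfl, h2⟩ | ⟨h1, h2⟩
    · rcases List.mem_cons.1 h2 with rfl | h2
      · exact .inr ⟨mem_insert_self _ _, fun _ => by simp⟩
      · exact .inl ⟨rfl, h2⟩
    · exact .inr ⟨mem_insert_of_mem h1, fun e => by simp [h2 e]⟩

/-- The neighbour `x` of `y` lies in a component reached before, and is put into the queue. -/
theorem Search.enqueue {x : Fin n} (h : Search G F L root es vis queue k y (x :: rem))
    (hx : L x ∈ vis) (hxq : x ∉ queue) :
    Search G F L root es vis (queue ++ [x]) k y rem where
  isForest := h.isForest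
  le := h.le
  adj := h.adj
  reachable := h.reachable
  nodup := by
    rw [List.nodup_append]
    exact ⟨h.nodup, by simp, fun a ha b hb e => hxq (List.mem_singleton.1 hb ▸ e ▸ ha)⟩
  mem_vis z hz := by
    rcases List.mem_append.1 hz with hz | hz
    · exact h.mem_vis z hz
    · rw [List.mem_singleton.1 hz]; exact hx
  exists_mem z hz := by
    obtain ⟨z', h1, h2⟩ := h.exists_mem z hz
    exact ⟨z', by simp [h1], h2⟩
  root_mem := by simp [h.root_mem]
  le_length := h.le_length.trans (by simp)
  closed z hz a ha := by
    rw [List.take_append_of_le_length h.le_length] at hz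
    rcases h.closed z hz a ha with ⟨rfl, h2⟩ | ⟨h1, h2⟩
    · rcases List.mem_cons.1 h2 with rfl | h2
      · exact .inr ⟨hx, fun _ => by simp⟩
      · exact .inl ⟨rfl, h2⟩
    · exact .inr ⟨h1, fun e => by simp [h2 e]⟩

theorem Search.skip {x : Fin n} (h : Search G F L root es vis queue k y (x :: rem))
    (hx : L x ∈ vis) (hxq : L x = L y → x ∈ queue) :
    Search G F L root es vis queue k y rem :=
  { h with
    closed := fun z hz a ha => by
      rcases h.closed z hz a ha with ⟨rfl, h2⟩ | h1
      · rcases List.mem_cons.1 h2 with rfl | h2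
        · exact .inr ⟨hx, hxq⟩
        · exact .inl ⟨rfl, h2⟩
      · exact .inr h1 }

theorem Search.next (h : Search G F L root es vis queue k y []) {z : Fin n}
    (hz : queue[k]? = some z) {adj : List (Fin n)} (hadj : ∀ x, G.Adj z x → x ∈ adj) :
    Search G F L root es vis queue (k + 1) z adj :=
  { h with
    le_length := (List.getElem?_eq_some_iff.1 hz).1
    closed := fun a ha x hax => by
      rw [List.take_add_one, hz] at ha
      rcases List.mem_append.1 ha with ha | ha
      · exact .inr (by simpa using h.closed a ha x hax)
      · obtain rfl : a = z := by simpa using ha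
        exact .inl ⟨rfl, hadj x hax⟩ }

/-- When the queue is exhausted, it contains every vertex of `G`, and every vertex of a component
reached is connected to the root by the edges found. -/
theorem Search.connected (h : Search G F L root es vis queue queue.length y [])
    (hL : IsQuotient G F L) (hG : G.Connected) : (graphOf es).Connected := by
  have hcl : ∀ z ∈ queue, ∀ x, G.Adj z x → L x ∈ vis ∧ (L x = L z → x ∈ queue) := by
    intro z hz x hzx
    simpa using h.closed z (by simpa using hz) x hzx
  -- The queue contains every vertex of a component as soon as it contains one of them.
  have hF : ∀ z ∈ queue, ∀ x, F.Reachable z x → x ∈ queue := by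
    rintro z hz x ⟨p⟩
    induction p with
    | nil => exact hz
    | cons hadj _ ih => exact ih ((hcl _ hz _ (hL.le hadj)).2 (hL.adj _ _ hadj).symm)
  have hGr : ∀ z ∈ queue, ∀ x, G.Reachable z x → x ∈ queue := by
    rintro z hz x ⟨p⟩
    induction p with
    | nil => exact hz
    | cons hadj _ ih =>
      obtain ⟨z', h1, h2⟩ := h.exists_mem _ (hcl _ hz _ hadj).1
      exact ih (hF z' h1 _ (hL.reachable _ _ h2))
  have hall : ∀ x, (graphOf es).Reachable root x := fun x =>
    h.reachable x (h.mem_vis x (hGr root h.root_mem x (hG.preconnected root x)))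
  have : Nonempty (Fin n) := ⟨root⟩
  exact ⟨fun x z => (hall x).symm.trans (hall z)⟩

end search

/-! ### Contents of the memory, punctuality, and the search phase -/

section memory

variable {n : ℕ}

/-- The blocks of the memory represent the labels, the progress of the search and the edges
found. -/
structure Holds (μ : ℕ → ℕ) (L : Fin n → ℕ) (vis : Finset ℕ) (queue : List (Fin n))
    (es : List (Fin n × Fin n)) : Prop where
  label : ∀ x : Fin n, μ x = L x
  vis : ∀ c ≤ n, μ (n + 1 + c) ≠ 0 ↔ c ∈ vis
  mark : ∀ x : Fin n, μ (2 * (n + 1) + x) ≠ 0 ↔ x ∈ queue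
  queue : ∀ (i : ℕ) (x : Fin n), queue[i]? = some x → μ (3 * (n + 1) + i) = x
  fst : ∀ (i : ℕ) (p : Fin n × Fin n), es[i]? = some p → μ (4 * (n + 1) + i) = p.1
  snd : ∀ (i : ℕ) (p : Fin n × Fin n), es[i]? = some p → μ (5 * (n + 1) + i) = p.2

variable {μ : ℕ → ℕ} {L : Fin n → ℕ} {vis : Finset ℕ} {queue : List (Fin n)}
  {es : List (Fin n × Fin n)}

theorem Holds.zero (h : ∀ i < 6 * (n + 1), μ i = 0) : Holds (n := n) μ (fun _ => 0) ∅ [] [] where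
  label x := h _ (by omega)
  vis c hc := by simp [h (n + 1 + c) (by omega)]
  mark x := by simp [h (2 * (n + 1) + x) (by omega)]
  queue := by simp
  fst := by simp
  snd := by simp

theorem Holds.setLabel (h : Holds μ L vis queue es) (v : Fin n) (l : ℕ) :
    Holds (Function.update μ v l) (Function.update L v l) vis queue es where
  label x := by
    obtain rfl | hx := eq_or_ne x v
    · simp
    · rw [Function.update_of_ne hx, Function.update_of_ne (Fin.val_ne_of_ne hx), h.label]
  vis c hc := by rw [Function.update_of_ne (by omega), h.vis c hc]
  mark x := by rw [Function.update_of_ne (by omega), h.mark]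
  queue i x hx := by rw [Function.update_of_ne (by omega), h.queue i x hx]
  fst i p hp := by rw [Function.update_of_ne (by omega), h.fst i p hp]
  snd i p hp := by rw [Function.update_of_ne (by omega), h.snd i p hp]

theorem Holds.visit (h : Holds μ L vis queue es) {c : ℕ} (hc : c ≤ n) :
    Holds (Function.update μ (n + 1 + c) 1) L (insert c vis) queue es where
  label x := by rw [Function.update_of_ne (by omega), h.label]
  vis d hd := by
    obtain rfl | hx := eq_or_ne d c
    · simp
    · rw [Function.update_of_ne (by omega), h.vis d hd, mem_insert]
      simp [hx]
  mark x := by rw [Function.update_of_ne (by omega), h.mark]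
  queue i x hx := by rw [Function.update_of_ne (by omega), h.queue i x hx]
  fst i p hp := by rw [Function.update_of_ne (by omega), h.fst i p hp]
  snd i p hp := by rw [Function.update_of_ne (by omega), h.snd i p hp]

theorem eq_or_getElem?_of_concat {α : Type*} {l : List α} {a b : α} {i : ℕ}
    (h : (l ++ [a])[i]? = some b) : i = l.length ∧ b = a ∨ i < l.length ∧ l[i]? = some b := by
  rcases lt_trichotomy i l.length with hi | rfl | hi
  · exact .inr ⟨hi, by rwa [List.getElem?_append_left hi] at h⟩
  · rw [List.getElem?_concat_length] at h
    exact .inl ⟨rfl, (Option.some.inj h).symm⟩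
  · rw [List.getElem?_eq_none (by simp; omega)] at h
    cases h

theorem Holds.concat (h : Holds μ L vis queue es) (p : Fin n × Fin n) (hq : queue.length ≤ n)
    (hes : es.length ≤ n) :
    Holds (Function.update (Function.update μ (4 * (n + 1) + es.length) p.1)
      (5 * (n + 1) + es.length) p.2) L vis queue (es ++ [p]) where
  label x := by
    rw [Function.update_of_ne (by omega), Function.update_of_ne (by omega), h.label]
  vis c hc := by
    rw [Function.update_of_ne (by omega), Function.update_of_ne (by omega), h.vis c hc]
  mark x := by rw [Function.update_of_ne (by omega), Function.update_of_ne (by omega), h.mark]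
  queue i x hx := by
    have := (List.getElem?_eq_some_iff.1 hx).1
    rw [Function.update_of_ne (by omega), Function.update_of_ne (by omega), h.queue i x hx]
  fst i p' hp := by
    rcases eq_or_getElem?_of_concat hp with ⟨rfl, rfl⟩ | ⟨hi, hp⟩
    · rw [Function.update_of_ne (by omega), Function.update_self]
    · rw [Function.update_of_ne (by omega), Function.update_of_ne (by omega), h.fst i p' hp]
  snd i p' hp := by
    rcases eq_or_getElem?_of_concat hp with ⟨rfl, rfl⟩ | ⟨hi, hp⟩
    · rw [Function.update_self]
    · rw [Function.update_of_ne (by omega), Function.update_of_ne (by omega), h.snd i p' hp]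

theorem Holds.enqueue (h : Holds μ L vis queue es) (x : Fin n) (hq : queue.length ≤ n) :
    Holds (Function.update (Function.update μ (2 * (n + 1) + x) 1)
      (3 * (n + 1) + queue.length) x) L vis (queue ++ [x]) es where
  label x := by
    rw [Function.update_of_ne (by omega), Function.update_of_ne (by omega), h.label]
  vis c hc := by
    rw [Function.update_of_ne (by omega), Function.update_of_ne (by omega), h.vis c hc]
  mark z := by
    rw [Function.update_of_ne (by omega)]
    obtain rfl | hx := eq_or_ne z x
    · simp
    · rw [Function.update_of_ne (by omega), h.mark]
      simp [hx]
  queue i z hz := by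
    rcases eq_or_getElem?_of_concat hz with ⟨rfl, rfl⟩ | ⟨hi, hz⟩
    · rw [Function.update_self]
    · rw [Function.update_of_ne (by omega), Function.update_of_ne (by omega), h.queue i z hz]
  fst i p hp := by
    rw [Function.update_of_ne (by omega), Function.update_of_ne (by omega), h.fst i p hp]
  snd i p hp := by
    rw [Function.update_of_ne (by omega), Function.update_of_ne (by omega), h.snd i p hp]

end memory

section time

variable {n : ℕ}

/-- The times `ts`, preceded by `0`, have gaps of at most `D`, and `last` is the last of them. -/
structure Punctual (D : ℕ) (ts : List ℕ) (last : ℕ) : Prop where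
  isChain : List.IsChain (fun a b => b ≤ a + D) (0 :: ts)
  getLast? : (0 :: ts).getLast? = some last

theorem Punctual.isChain_concat {D : ℕ} {ts : List ℕ} {last t : ℕ} (h : Punctual D ts last)
    (ht : t ≤ last + D) : List.IsChain (fun a b => b ≤ a + D) (0 :: ts ++ [t]) := by
  rw [List.isChain_append]
  refine ⟨h.isChain, by simp, fun a ha b hb => ?_⟩
  rw [h.getLast?, Option.mem_some_iff] at ha
  rw [List.head?_cons, Option.mem_some_iff] at hb
  omega

theorem Punctual.concat {D : ℕ} {ts : List ℕ} {last t : ℕ} (h : Punctual D ts last)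
    (ht : t ≤ last + D) : Punctual D (ts ++ [t]) t where
  isChain := h.isChain_concat ht
  getLast? := by rw [← List.cons_append, List.getLast?_concat]

/-- The emissions are the first `hd` edges of `es` and were punctual, and the time since the last
of them is at most `40` units for each iteration counted by the clock, with a slack `s`. The number
`40` is an upper bound on the number of instructions in one iteration of the main loop, not
counting the emission of an edge, which sets the clock to `0`. -/
structure Timely (D s : ℕ) (es : List (Fin n × Fin n)) (σ : State) : Prop where
  length : es.length = σ.tl
  le : σ.hd ≤ σ.tl
  out : σ.out.map (fun e => e.2) = (es.take σ.hd).map fun p => (p.1.val, p.2.val)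
  gap : ∃ last, Punctual D (σ.out.map fun e => e.1) last ∧ σ.time ≤ last + 40 * σ.ctr + s

variable {D s : ℕ} {es : List (Fin n × Fin n)} {σ : State} {w : ℕ} {I : Memory w}
  {Q : Config treeProgram w → Prop} {L : Fin n → ℕ} {vis : Finset ℕ} {queue : List (Fin n)}

theorem Timely.runs_pop (hT : Timely D s es σ) (hW : 7 * (n + 1) ≤ 2 ^ w) (htl : σ.tl ≤ n)
    (hH : Holds σ.mem L vis queue es) (hD : 40 * σ.ctr + s + 6 ≤ D) (hlt : σ.hd < σ.tl)
    (h : ∀ t o, Timely D 1 es { σ with hd := σ.hd + 1, ctr := 0, time := t, out := o } →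
      Runs I Q n 10 { σ with hd := σ.hd + 1, ctr := 0, time := t, out := o }) :
    Runs I Q n 80 σ := by
  have hget : es[σ.hd]? = some (es[σ.hd]'(hT.length ▸ hlt)) := by simp
  generalize es[σ.hd]'(hT.length ▸ hlt) = p at hget
  refine .pop hW (by omega) (h _ _ ⟨hT.length, hlt, ?_, σ.time + 6, ?_, ?_⟩)
  · simp only [List.map_append, hT.out, List.take_add_one, hget, hH.fst _ p hget,
      hH.snd _ p hget, Option.toList_some, List.map_cons, List.map_nil]
  · obtain ⟨last, hl, ht⟩ := hT.gap
    simp only [List.map_append, List.map_cons, List.map_nil]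
    exact hl.concat (by omega)
  · simp

theorem Timely.runs_tick (hT : Timely D (s + 38) es σ) (hW : 7 * (n + 1) ≤ 2 ^ w)
    (htl : σ.tl ≤ n) (hH : Holds σ.mem L vis queue es) (hctr : σ.ctr < σ.B)
    (hB : σ.B ≤ 4 * (n + 1)) (hD : 40 * σ.B + s + 10 ≤ D) (hs : 1 ≤ s)
    (hpop : σ.ctr + 1 = σ.B → σ.hd < σ.tl)
    (h : ∀ hd c t o, Timely D s es { σ with hd := hd, ctr := c, time := t, out := o } →
      c < σ.B → σ.B * hd + c = σ.B * σ.hd + σ.ctr + 1 →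
      Runs I Q n 10 { σ with hd := hd, ctr := c, time := t, out := o }) :
    Runs I Q n 77 σ := by
  obtain ⟨last, hl, ht⟩ := hT.gap
  have hT' : Timely D s es { σ with ctr := σ.ctr + 1, time := σ.time + 2 } :=
    ⟨hT.length, hT.le, hT.out, last, hl, by simp only; omega⟩
  refine .clock (by omega) (fun hc => ?_) (fun hc => ?_)
  · exact h σ.hd (σ.ctr + 1) (σ.time + 2) σ.out hT' hc (by omega)
  · refine hT'.runs_pop hW htl hH (by simp only; omega) (hpop (by omega)) fun t o hT'' => ?_
    refine h _ _ _ _ ⟨hT''.length, hT''.le, hT''.out, ?_⟩ (by omega) ?_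
    · obtain ⟨last, hl, ht⟩ := hT''.gap
      exact ⟨last, hl, by simp only at ht ⊢; omega⟩
    · change σ.B * (σ.hd + 1) + 0 = σ.B * σ.hd + σ.ctr + 1
      rw [mul_add]; omega

end time

section phases

variable {n w : ℕ}

/-- The program has halted as required, with gaps of at most `D` between emissions. -/
structure Finished (G : SimpleGraph (Fin n)) (D : ℕ) (s : Config treeProgram w) : Prop where
  label : s.label = (87 : Fin 88)
  space : s.space = 6 * (n + 1)
  lazySpace : s.lazySpace = 6 * (n + 1)
  tree : ListsSpanningTree G s.emitEdges
  isChain : List.IsChain (fun a b => b ≤ a + D) (0 :: s.emitTimes ++ [s.time])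

variable {G : SimpleGraph (Fin n)} {D s : ℕ} {es : List (Fin n × Fin n)} {σ : State}
  {I : Memory w} {L : Fin n → ℕ} {vis : Finset ℕ} {queue : List (Fin n)}

theorem Timely.runs_halt (hT : Timely D s es σ) (heq : σ.hd = σ.tl) (hD : 40 * σ.ctr + s ≤ D)
    (hF : IsForest G es) (hC : (graphOf es).Connected) :
    Runs I (Finished G D) n 87 σ := by
  intro t u d e
  refine .halt fun c hc => ⟨hc.label, hc.space, hc.lazySpace, ?_, ?_⟩
  · have : c.emitEdges = es.map fun p => s(p.1.val, p.2.val) := by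
      have h1 := congrArg (List.map fun q : ℕ × ℕ => s(q.1, q.2)) hT.out
      rw [heq, ← hT.length, List.take_length, ← hc.out] at h1
      simpa [Config.emitEdges, Function.comp_def] using h1
    rw [this]
    exact hF.listsSpanningTree hC
  · obtain ⟨last, hl, ht⟩ := hT.gap
    have : c.emitTimes = σ.out.map fun e => e.1 := by
      simp [Config.emitTimes, ← hc.out, Function.comp_def]
    rw [this, hc.time]
    exact hl.isChain_concat (by omega)

theorem Timely.runs_flush (hT : Timely D s es σ) (hW : 7 * (n + 1) ≤ 2 ^ w) (htl : σ.tl ≤ n)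
    (hH : Holds σ.mem L vis queue es) (hD : 40 * σ.ctr + s + 10 ≤ D) (hD' : 15 ≤ D)
    (hF : IsForest G es) (hC : (graphOf es).Connected) (hv : σ.v = n) (hp : σ.p = 0)
    (hqt : σ.qt ≠ 0) (hqh : σ.qh = σ.qt) (hqn : σ.qt ≤ n) :
    Runs I (Finished G D) n 79 σ := by
  induction hm : σ.tl - σ.hd generalizing σ s with
  | zero =>
    obtain ⟨last, hl, ht⟩ := hT.gap
    have hT' : Timely D (s + 1) es { σ with time := σ.time + 1 } :=
      ⟨hT.length, hT.le, hT.out, last, hl, by simp only; omega⟩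
    have := hT.le
    exact .flush (fun hc => hT'.runs_halt hc (by simp only; omega) hF hC)
      (fun hc => absurd hc (by omega))
  | succ m ih =>
    obtain ⟨last, hl, ht⟩ := hT.gap
    have hT' : Timely D (s + 1) es { σ with time := σ.time + 1 } :=
      ⟨hT.length, hT.le, hT.out, last, hl, by simp only; omega⟩
    refine .flush (fun hc => absurd hc (by omega)) (fun hc => ?_)
    refine hT'.runs_pop hW htl hH (by simp only; omega) (by simp only; omega) fun t o hT'' => ?_
    refine .head (fun hc => absurd hc (by simp only; omega)) (fun _ => ?_)
    refine .test (fun hc => absurd hc hqt) (fun _ => ?_)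
    refine .step_of_p_eq_zero hp ?_
    refine .take (x := 0) hW (by simp only; omega) (fun hc => absurd hc (by simp only; omega))
      (fun _ => ?_) (fun hc => absurd hc (by simp only; omega))
    refine ih (s := 5) (σ := { σ with
      hd := σ.hd + 1, ctr := 0, time := t + 1 + 1 + 1 + 1, out := o })
      ⟨hT''.length, hT''.le, hT''.out, ?_⟩ htl hH (by simp only; omega) hv hp hqt
      hqh hqn (by simp only; omega)
    obtain ⟨last, hl, ht⟩ := hT''.gap
    exact ⟨last, hl, by simp only at ht ⊢; omega⟩

/-- The input holds the adjacency lists `adj` of `G`. -/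
structure IsAdjacency (I : Memory w) (G : SimpleGraph (Fin n)) (adj : Fin n → List (Fin n)) :
    Prop where
  nodup : ∀ v, (adj v).Nodup
  mem_iff : ∀ v u, u ∈ adj v ↔ G.Adj v u
  length : ∀ v, (I (BitVec.ofNat w (2 * v.val + 1))).toNat = (adj v).length
  list : ∀ v, IsLinkedList I (I (BitVec.ofNat w (2 * v.val + 2))) (adj v)

theorem IsAdjacency.length_lt {adj : Fin n → List (Fin n)} (h : IsAdjacency I G adj) (v : Fin n) :
    (adj v).length < n := by
  have : (adj v).toFinset ⊆ univ.erase v := by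
    intro u hu
    simpa using ((h.mem_iff v u).1 (List.mem_toFinset.1 hu)).ne'
  have := card_le_card this
  rw [List.toFinset_card_of_nodup (h.nodup v), card_erase_of_mem (mem_univ v), card_univ,
    Fintype.card_fin] at this
  have := v.isLt
  omega

/-- The invariant of the main loop during the search. The number `a` is the integral part of the
average degree. -/
structure Searching (I : Memory w) (G F : SimpleGraph (Fin n)) (adj : Fin n → List (Fin n))
    (D a : ℕ) (L : Fin n → ℕ) (root : Fin n) (es : List (Fin n × Fin n)) (vis : Finset ℕ)
    (queue : List (Fin n)) (y : Fin n) (rem : List (Fin n)) (σ : State) : Prop where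
  search : Search G F L root es vis queue σ.qh y rem
  holds : Holds σ.mem L vis queue es
  timely : Timely D 60 es σ
  v_eq : σ.v = n
  B_eq : σ.B = 4 * (a + 2)
  ctr_lt : σ.ctr < σ.B
  qt_eq : σ.qt = queue.length
  list : ∃ p : BitVec w, σ.p = p.toNat ∧ IsLinkedList I p rem
  current : rem ≠ [] → σ.y = y ∧ σ.c = L y ∧ y ∈ queue
  adj_current : ∀ x ∈ rem, G.Adj y x
  /-- An iteration takes a vertex from the queue or reads an entry of its adjacency list. The sum
  minus the length of `rem` counts these iterations; `(a + 2) * n` covers the first phase. -/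
  work : σ.B * σ.hd + σ.ctr + rem.length ≤
    (a + 2) * n + ((queue.take σ.qh).map fun x => (adj x).length + 1).sum
  le_two_mul : n ≤ 2 * σ.tl

theorem sum_take_le {queue : List (Fin n)} (h : queue.Nodup) (f : Fin n → ℕ) (k : ℕ) :
    ((queue.take k).map f).sum ≤ ∑ x, f x := by
  rw [← List.sum_toFinset f (h.sublist (List.take_sublist _ _))]
  exact sum_le_sum_of_subset (subset_univ _)

theorem length_le_of_nodup {queue : List (Fin n)} (h : queue.Nodup) : queue.length ≤ n := by
  simpa using h.length_le_card

/-- The induction is on the number of neighbours still to be read and vertices still to be taken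
from the queue. -/
theorem Searching.runs {F : SimpleGraph (Fin n)} {adj : Fin n → List (Fin n)} {a : ℕ}
    {root y : Fin n} {rem : List (Fin n)} (hW : 7 * (n + 1) ≤ 2 ^ w) (hadj : IsAdjacency I G adj)
    (hG : G.Connected) (hL : IsQuotient G F L) (hLn : ∀ x, L x ≤ n)
    (ha : ∑ x, (adj x).length < (a + 1) * n) (han : a + 1 ≤ n) (hD : 160 * (a + 2) + 100 ≤ D)
    (h : Searching I G F adj D a L root es vis queue y rem σ) :
    Runs I (Finished G D) n 10 σ := by
  have hn : 0 < n := by omega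
  induction hm : (∑ x, ((adj x).length + 1)) + rem.length -
    ((queue.take σ.qh).map fun x => (adj x).length + 1).sum using Nat.strong_induction_on
    generalizing es vis queue y rem σ with
  | _ m ih =>
  have hqn := length_le_of_nodup h.search.nodup
  have hqt := h.qt_eq
  have hB := h.B_eq
  have hlen := h.timely.length
  have htl := h.search.isForest.length_lt hn
  have hk := h.search.le_length
  have hq0 : queue.length ≠ 0 := by
    have := List.length_pos_of_mem h.search.root_mem
    omega
  have hsum : ∑ x, ((adj x).length + 1) < (a + 2) * n := by
    rw [sum_add_distrib]
    simp only [sum_const, card_univ, Fintype.card_fin, smul_eq_mul, mul_one]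
    linarith
  obtain ⟨last, hl, ht⟩ := h.timely.gap
  -- Whatever one step of the search leads to, the clock finds an edge in the buffer when it needs
  -- one, since the buffer starts with at least `n / 4` edges.
  have tick : ∀ (es' : List (Fin n × Fin n)) (vis' : Finset ℕ) (queue' : List (Fin n)) (y' : Fin n)
      (rem' : List (Fin n)) (σ' : State), σ'.hd = σ.hd → σ'.ctr = σ.ctr → σ'.B = σ.B →
      σ'.out = σ.out → σ'.v = σ.v →
      σ'.time ≤ σ.time + 30 → (∃ l, es' = es ++ l) → es'.length = σ'.tl →
      Search G F L root es' vis' queue' σ'.qh y' rem' → Holds σ'.mem L vis' queue' es' →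
      σ'.qt = queue'.length → (∃ p : BitVec w, σ'.p = p.toNat ∧ IsLinkedList I p rem') →
      (rem' ≠ [] → σ'.y = y' ∧ σ'.c = L y' ∧ y' ∈ queue') → (∀ x ∈ rem', G.Adj y' x) →
      rem'.length + 1 + ((queue.take σ.qh).map fun x => (adj x).length + 1).sum =
        rem.length + ((queue'.take σ'.qh).map fun x => (adj x).length + 1).sum →
      Runs I (Finished G D) n 77 σ' := by
    intro es' vis' queue' y' rem' σ' e1 e2 e3 e4 e4' e5 e6 e7 e8 e9 e10 e11 e12 e13 e14
    have htl' := e8.isForest.length_lt hn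
    have hwork := h.work
    have hS := sum_take_le e8.nodup (fun x => (adj x).length + 1) σ'.qh
    have hS' := sum_take_le h.search.nodup (fun x => (adj x).length + 1) σ.qh
    have htl2 : σ.tl ≤ σ'.tl := by
      obtain ⟨l, rfl⟩ := e6
      rw [← e7, ← hlen, List.length_append]
      omega
    have hT : Timely D (60 + 38) es' σ' := by
      refine ⟨e7, ?_, ?_, last, ?_, ?_⟩
      · rw [e1]; exact h.timely.le.trans htl2
      · obtain ⟨l, rfl⟩ := e6
        rw [e4, e1, List.take_append_of_le_length (by rw [hlen]; exact h.timely.le)]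
        exact h.timely.out
      · rw [e4]; exact hl
      · rw [e2]; omega
    refine hT.runs_tick hW (by omega) e9 (by rw [e2, e3]; exact h.ctr_lt) (by omega) (by omega)
      (by omega) (fun hc => ?_) (fun hd c t o hT' hc1 hc2 => ?_)
    · have h2 := h.le_two_mul
      by_contra hlt
      have h3 : (a + 2) * n ≤ (a + 2) * (2 * σ.hd) := Nat.mul_le_mul_left _ (by omega)
      have h4 : σ.B * σ.hd = 2 * ((a + 2) * (2 * σ.hd)) := by rw [hB]; ring
      omega
    · refine ih _ ?_ (σ := { σ' with hd := hd, ctr := c, time := t, out := o })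
        ⟨e8, e9, hT', e4'.trans h.v_eq, e3.trans hB, hc1, e10, e11, e12, e13, ?_, ?_⟩ rfl
      · simp only
        omega
      · simp only
        rw [hc2, e1, e2, e3]
        omega
      · have := h.le_two_mul
        simp only
        omega
  refine .head (fun hc => absurd hc (by rw [h.v_eq]; omega)) (fun _ => ?_)
  refine .test (fun hc => absurd hc (by simp only; omega)) (fun _ => ?_)
  obtain ⟨p, hp, hlist⟩ := h.list
  cases rem with
  | nil =>
    have hp0 : σ.p = 0 := by rw [hp, show p = 0 from hlist]; simp
    refine .step_of_p_eq_zero hp0 ?_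
    by_cases hqq : σ.qh < queue.length
    · have hget : queue[σ.qh]? = some queue[σ.qh] := by simp
      generalize queue[σ.qh] = z at hget
      refine .take (x := z) hW (by simp only; omega) (fun _ => ⟨h.holds.queue _ _ hget, z.isLt⟩)
        (fun hc => absurd hc (by simp only; omega)) (fun _ => ?_)
      refine tick es vis queue z (adj z) _ rfl rfl rfl rfl rfl (by simp only; omega)
        ⟨[], by simp⟩ hlen
        (h.search.next hget fun x hx => (hadj.mem_iff z x).2 hx) h.holds hqt
        ⟨_, rfl, hadj.list z⟩ (fun _ => ⟨rfl, h.holds.label z, List.mem_of_getElem? hget⟩)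
        (fun x hx => (hadj.mem_iff z x).1 hx) ?_
      simp only [List.take_add_one, hget, Option.toList_some, List.map_append, List.sum_append,
        List.map_cons, List.map_nil, List.sum_cons, List.sum_nil, List.length_nil]
      omega
    · refine .take (x := 0) hW (by simp only; omega) (fun hc => absurd hc (by simp only; omega))
        (fun _ => ?_) (fun hc => absurd hc (by simp only; omega))
      have hs := h.search
      have hctr := h.ctr_lt
      rw [show σ.qh = queue.length by omega] at hs
      exact Timely.runs_flush (s := 70) ⟨hlen, h.timely.le, h.timely.out, last, hl,
        by simp only; omega⟩ hW (by simp only; omega) h.holds (by simp only; omega) (by omega)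
        hs.isForest (hs.connected hL hG) h.v_eq hp0 (by simp only; omega) (by simp only; omega)
        (by simp only; omega)
  | cons x rem =>
    obtain ⟨hp0, hx, hlist'⟩ := hlist
    obtain ⟨hy, hc, hyq⟩ := h.current (by simp)
    have hpp : BitVec.ofNat w σ.p = p := by rw [hp]; simp
    have hpne : σ.p ≠ 0 := by
      rw [hp]
      exact fun e => hp0 (BitVec.eq_of_toNat_eq (by simpa using e))
    have hadjx := h.adj_current x (by simp)
    have hlab := h.holds.label x
    have hLx := hLn x
    refine .scan (x := x) hW hpne (by simp only; omega) (by simp only; omega)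
      (by simp only; rw [hpp, hx]) x.isLt rfl (by simp only; rw [hlab]; exact hLx)
      fun t ht' => ⟨fun hc1 => ?_, fun hc1 hc2 hc3 => ?_, fun hc1 hc2 => ?_⟩
    · rw [hlab] at hc1
      have hv : L x ∉ vis := fun e => (h.holds.vis _ hLx).2 e hc1
      have hs := h.search.link hL (h.search.mem_vis y hyq) hv hadjx
      refine tick (es ++ [(y, x)]) _ _ y rem _ rfl rfl rfl rfl rfl (by simp only at ht' ⊢; omega)
        ⟨_, rfl⟩ (by simp [hlen]) hs ?_ (by simp [hqt]) ⟨_, rfl, by simpa [hpp] using hlist'⟩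
        (fun _ => ⟨hy, hc, by simp [hyq]⟩) (fun z hz => h.adj_current z (by simp [hz])) ?_
      · have := ((h.holds.visit hLx).concat (y, x) hqn (by omega)).enqueue x hqn
        simpa only [hlab, hlen, hqt, hy] using this
      · rw [List.take_append_of_le_length hk]; simp
    · rw [hlab] at hc1 hc2
      have hv : L x ∈ vis := (h.holds.vis _ hLx).1 hc1
      have hxq : x ∉ queue := fun e => (h.holds.mark x).2 e hc3
      refine tick es _ _ y rem _ rfl rfl rfl rfl rfl (by simp only at ht' ⊢; omega)
        ⟨[], by simp⟩ hlen (h.search.enqueue hv hxq) ?_ (by simp [hqt])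
        ⟨_, rfl, by simpa [hpp] using hlist'⟩
        (fun _ => ⟨hy, hc, by simp [hyq]⟩) (fun z hz => h.adj_current z (by simp [hz])) ?_
      · simpa only [hqt] using h.holds.enqueue x hqn
      · rw [List.take_append_of_le_length hk]; simp
    · rw [hlab] at hc1 hc2
      have hv : L x ∈ vis := (h.holds.vis _ hLx).1 hc1
      refine tick es _ _ y rem _ rfl rfl rfl rfl rfl (by simp only at ht' ⊢; omega)
        ⟨[], by simp⟩ hlen
        (h.search.skip hv fun e => (h.holds.mark x).1 (hc2 (e.trans hc.symm))) h.holds hqt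
        ⟨_, rfl, by simpa [hpp] using hlist'⟩
        (fun _ => ⟨hy, hc, hyq⟩) (fun z hz => h.adj_current z (by simp [hz])) ?_
      simp

end phases

/-! ### Growing the first forest, and the whole run -/

section phases

variable {n w : ℕ} {G : SimpleGraph (Fin n)} {D : ℕ} {es : List (Fin n × Fin n)} {σ : State}
  {I : Memory w} {L : Fin n → ℕ} {adj : Fin n → List (Fin n)}

/-- The invariant of the main loop while the first forest grows. -/
structure Growing (G : SimpleGraph (Fin n)) (adj : Fin n → List (Fin n)) (D : ℕ) (L : Fin n → ℕ)
    (es : List (Fin n × Fin n)) (σ : State) : Prop where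
  labels : Labels es L
  isForest : IsForest G es
  holds : Holds σ.mem L ∅ [] es
  timely : Timely D 30 es σ
  v_le : σ.v ≤ n
  ctr_lt : σ.ctr < 4
  B_eq : σ.B = 4
  clock : 4 * σ.hd + σ.ctr = σ.v
  label_ne_zero : ∀ x : Fin n, x < σ.v → L x ≠ 0
  degrees : σ.q * n + σ.r = ∑ x : Fin n with x.val < σ.v, (adj x).length
  r_lt : σ.r < n
  p_eq : σ.p = 0
  qh_eq : σ.qh = 0
  qt_eq : σ.qt = 0

theorem IsAdjacency.sum_le (h : IsAdjacency I G adj) (s : Finset (Fin n)) :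
    ∑ x ∈ s, (adj x).length ≤ n * (n - 1) := by
  calc ∑ x ∈ s, (adj x).length ≤ ∑ x, (adj x).length := sum_le_sum_of_subset (subset_univ _)
    _ ≤ ∑ x : Fin n, (n - 1) := sum_le_sum fun x _ => by have := h.length_lt x; omega
    _ = n * (n - 1) := by simp

theorem sum_lt_succ (f : Fin n → ℕ) (v : Fin n) :
    ∑ x : Fin n with x.val < v.val + 1, f x = (∑ x : Fin n with x.val < v.val, f x) + f v := by
  have : univ.filter (fun x : Fin n => x.val < v.val + 1) =
      insert v (univ.filter fun x : Fin n => x.val < v.val) := by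
    ext x
    simp only [mem_filter, mem_univ, true_and, mem_insert, Fin.ext_iff]
    omega
  rw [this, sum_insert (by simp), add_comm]

theorem Growing.q_lt (h : Growing G adj D L es σ) (hadj : IsAdjacency I G adj) (hn : 0 < n) :
    σ.q < n := by
  have h1 := hadj.sum_le (univ.filter fun x : Fin n => x.val < σ.v)
  rw [← h.degrees] at h1
  by_contra hq
  have h2 : n * n ≤ σ.q * n := Nat.mul_le_mul_right _ (not_lt.1 hq)
  have h3 : n * (n - 1) < n * n := Nat.mul_lt_mul_of_pos_left (by omega) hn
  omega

theorem Growing.isQuotient (h : Growing G adj D L es σ) (hv : σ.v = n) :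
    IsQuotient G (graphOf es) L where
  le := h.isForest.le
  adj := h.labels.adj
  reachable x z hxz := h.labels.reachable (h.label_ne_zero x (hv ▸ x.isLt)) hxz

theorem Growing.runs (hW : 7 * (n + 1) ≤ 2 ^ w) (hadj : IsAdjacency I G adj)
    (hG : G.Connected) (hn : 2 ≤ n) (hD : 160 * ((∑ x, (adj x).length) / n + 2) + 100 ≤ D)
    (h : Growing G adj D L es σ) : Runs I (Finished G D) n 10 σ := by
  have hlen := h.timely.length
  have htl := h.isForest.length_lt (by omega)
  have hq := h.q_lt hadj (by omega)
  obtain ⟨last, hl, ht⟩ := h.timely.gap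
  induction hm : n - σ.v generalizing L es σ last with
  | zero =>
    have hv : σ.v = n := le_antisymm h.v_le (by omega)
    have hdeg := h.degrees
    rw [hv, filter_true_of_mem fun x _ => x.isLt] at hdeg
    have hdiv : (∑ x, (adj x).length) / n = σ.q := by
      rw [← hdeg, add_comm, Nat.add_mul_div_right _ _ (by omega), Nat.div_eq_of_lt h.r_lt,
        zero_add]
    have hmem0 : σ.mem 0 = L ⟨0, by omega⟩ := h.holds.label ⟨0, by omega⟩
    have hL0 := h.labels.le ⟨0, by omega⟩
    have hclock := h.clock
    have hctr := h.ctr_lt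
    refine .head (fun hc => absurd hc (by omega)) (fun _ => ?_)
    refine .test (fun _ => ?_) (fun hc => absurd h.qt_eq hc)
    refine .prepare hW (by simp only; omega) (by simp only; omega) ?_
    refine Searching.runs (F := graphOf es) (adj := adj) (a := σ.q) (root := ⟨0, by omega⟩)
      (y := ⟨0, by omega⟩) (rem := []) (es := es) (queue := [⟨0, by omega⟩])
      (vis := {L ⟨0, by omega⟩}) hW hadj hG (h.isQuotient hv) h.labels.le ?_ hq
      (by rw [← hdiv]; exact hD) ?_
    · rw [← hdeg, add_mul]
      have := h.r_lt
      omega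
    · refine ⟨?_, ?_, ?_, hv, rfl, by simp only; omega, rfl, ⟨0, ?_, rfl⟩, by simp, by simp,
        ?_, ?_⟩
      · simp only [h.qh_eq]
        exact Search.start h.isForest (h.isQuotient hv) _ _
      · have := (h.holds.visit hL0).enqueue ⟨0, by omega⟩ (by simp)
        simpa [hmem0] using this
      · exact ⟨hlen, h.timely.le, h.timely.out, last, hl, by simp only; omega⟩
      · simp [h.p_eq]
      · simp only [h.qh_eq, List.take_zero, List.map_nil, List.sum_nil, List.length_nil, add_zero]
        calc 4 * (σ.q + 2) * σ.hd + σ.ctr = (σ.q + 2) * (4 * σ.hd) + σ.ctr := by ring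
          _ ≤ (σ.q + 2) * (4 * σ.hd) + (σ.q + 2) * σ.ctr := by nlinarith
          _ = (σ.q + 2) * n := by rw [← mul_add, hclock, hv]
      · simp only
        rw [← hlen]
        exact h.labels.le_two_mul_length le_rfl fun x _ => h.label_ne_zero x (hv ▸ x.isLt)
  | succ m ih =>
    have hv : σ.v < n := by omega
    obtain ⟨v, hvv⟩ : ∃ v : Fin n, v.val = σ.v := ⟨⟨σ.v, hv⟩, rfl⟩
    have hlab := h.holds.label v
    have hB := h.B_eq
    have hctr := h.ctr_lt
    have hclock := h.clock
    have : Nontrivial (Fin n) := Fin.nontrivial_iff_two_le.2 hn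
    obtain ⟨z, hz⟩ := hG.preconnected.exists_adj_of_nontrivial v
    obtain ⟨u, l, hul⟩ := List.exists_cons_of_ne_nil
      (List.ne_nil_of_mem ((hadj.mem_iff v z).2 hz))
    have hvu : G.Adj v u := (hadj.mem_iff v u).1 (by simp [hul])
    have hlabu := h.holds.label u
    have hlist := hadj.list v
    rw [hul] at hlist
    have hD' : 260 ≤ D := by
      generalize (∑ x, (adj x).length) / n = a at hD
      omega
    -- In each case there is an edge for every second vertex, and the clock asks for one edge every
    -- four vertices.
    have tick : ∀ (es' : List (Fin n × Fin n)) (L' : Fin n → ℕ) (σ' : State), σ'.hd = σ.hd →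
        σ'.ctr = σ.ctr → σ'.B = σ.B → σ'.out = σ.out → σ'.v = σ.v + 1 → σ'.p = σ.p →
        σ'.qh = σ.qh → σ'.qt = σ.qt → σ'.time ≤ σ.time + 30 → (∃ l, es' = es ++ l) →
        es'.length = σ'.tl → Labels es' L' → IsForest G es' → Holds σ'.mem L' ∅ [] es' →
        (∀ x : Fin n, x < σ.v + 1 → L' x ≠ 0) →
        σ'.q * n + σ'.r = σ.q * n + σ.r + (adj v).length → σ'.r < n →
        Runs I (Finished G D) n 77 σ' := by
      intro es' L' σ' e1 e2 e3 e4 e5 e5' e5'' e5''' e6 e7 e8 e9 e10 e11 e12 e13 e14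
      have htl' := e10.length_lt (by omega)
      have hhalf := e9.le_two_mul_length (v := σ.v + 1) (by omega) e12
      have htl2 : σ.tl ≤ σ'.tl := by
        obtain ⟨l, rfl⟩ := e7
        rw [← e8, ← hlen, List.length_append]
        omega
      have hT : Timely D (30 + 38) es' σ' := by
        refine ⟨e8, ?_, ?_, last, ?_, ?_⟩
        · rw [e1]; exact h.timely.le.trans htl2
        · obtain ⟨l, rfl⟩ := e7
          rw [e4, e1, List.take_append_of_le_length (by rw [hlen]; exact h.timely.le)]
          exact h.timely.out
        · rw [e4]; exact hl
        · rw [e2]; omega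
      refine hT.runs_tick hW (by omega) e11 (by omega) (by omega) (by rw [e3, hB]; omega)
        (by omega) (fun hc => by omega) (fun hd c t o hT' hc1 hc2 => ?_)
      have hgr : Growing G adj D L' es'
          { σ' with hd := hd, ctr := c, time := t, out := o } := by
        refine ⟨e9, e10, e11, hT', by simp only; omega, by simp only; omega, e3.trans hB,
          ?_, ?_, ?_, e14, e5'.trans h.p_eq, e5''.trans h.qh_eq, e5'''.trans h.qt_eq⟩
        · simp only
          rw [e3, hB, e1, e2] at hc2
          omega
        · intro x hx
          exact e12 x (by simp only at hx; omega)
        · simp only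
          rw [e13, h.degrees, e5, ← hvv, sum_lt_succ]
      obtain ⟨last', hl', ht'⟩ := hT'.gap
      exact ih hgr e8 htl' (hgr.q_lt hadj (by omega)) last' hl' ht' (by simp only; omega)
    refine .head (fun _ => ?_) (fun hc => absurd hv hc)
    refine .addDegree (g := (adj v).length) hW hv h.r_lt (by simp only; omega)
      (by rw [← hadj.length, hvv]) (hadj.length_lt v) fun t' q' r' ht' hq' hr' => ?_
    refine Ensures.pick (x := u) hW hv (by simp only; omega) (by rw [← hvv, hlist.2.1]) u.isLt
      fun t'' ht'' => ⟨fun hc => ?_, fun hc hcu => ?_, fun hc hcu => ?_⟩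
    · simp only [← hvv, hlab] at hc
      refine tick es L _ rfl rfl rfl rfl rfl rfl rfl rfl (by simp only at ht' ht'' ⊢; omega)
        ⟨[], by simp⟩ hlen h.labels h.isForest h.holds (fun x hx => ?_) hq' hr'
      obtain hx | hx := Nat.lt_succ_iff_lt_or_eq.1 hx
      · exact h.label_ne_zero x hx
      · rwa [Fin.ext (hx.trans hvv.symm)]
    · simp only [← hvv, hlab, hlabu] at hc hcu
      refine tick (es ++ [(v, u)]) (Function.update L v (L u)) _ rfl rfl rfl rfl rfl rfl rfl rfl
        (by simp only at ht' ht'' ⊢; omega)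
        ⟨_, rfl⟩ (by simp [hlen]) (h.labels.concat hc hcu)
        (h.labels.isForest_concat h.isForest hc hvu)
        ?_ (fun x hx => ?_) hq' hr'
      · have := (h.holds.setLabel v (L u)).concat (v, u) (by simp) (by omega)
        simpa only [hvv, hlabu, hlen] using this
      · by_cases hxv : x = v
        · subst hxv; simpa using hcu
        · rw [Function.update_of_ne hxv]
          exact h.label_ne_zero x (by have := Fin.val_ne_of_ne hxv; omega)
    · simp only [← hvv, hlab, hlabu] at hc hcu
      refine tick (es ++ [(v, u)]) (Function.update (Function.update L u (u + 1)) v (u + 1)) _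
        rfl rfl rfl rfl rfl rfl rfl rfl (by simp only at ht' ht'' ⊢; omega)
        ⟨_, rfl⟩ (by simp [hlen]) (h.labels.concat_fresh hc hcu hvu.ne)
        (h.labels.isForest_concat h.isForest hc hvu)
        ?_ (fun x hx => ?_) hq' hr'
      · have := ((h.holds.setLabel u (u + 1)).setLabel v (u + 1)).concat (v, u) (by simp) (by omega)
        simpa only [hvv, hlen] using this
      · by_cases hxv : x = v
        · subst hxv; simp
        by_cases hxu : x = u
        · subst hxu; simp [hxv]
        rw [Function.update_of_ne hxv, Function.update_of_ne hxu]
        exact h.label_ne_zero x (by have := Fin.val_ne_of_ne hxv; omega)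

end phases

theorem exists_finished {n w : ℕ} {G : SimpleGraph (Fin n)} {I : Memory w} (M : Memory w)
    (hn : 2 ≤ n) (hG : G.Connected) (hW : 7 * (n + 1) ≤ 2 ^ w) (hI : (I 0).toNat = n)
    {adj : Fin n → List (Fin n)} (hadj : IsAdjacency I G adj) :
    ∃ s, treeProgram.HaltsIn I M s ∧
      Finished G (160 * ((∑ x, (adj x).length) / n + 2) + 100) s := by
  obtain ⟨s, hs, hf⟩ := exists_of_runs hW hI M fun μ hμ =>
    Growing.runs (L := fun _ => 0) (es := []) hW hadj hG hn le_rfl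
      ⟨.nil, .nil, .zero hμ, ⟨rfl, le_rfl, rfl, 0, ⟨by simp [State.initial], rfl⟩,
        by simp [State.initial]⟩,
        by simp [State.initial], by simp [State.initial], rfl, rfl, by simp [State.initial],
        by simp [State.initial], by simp [State.initial]; omega, rfl, rfl, rfl⟩
  exact ⟨s, ⟨hs, by rw [hf.label]; rfl⟩, hf⟩

end WordRAM

theorem mainTheorem1 :
    ∃ (P : WordRAM.Program) (K : ℕ) (c C : ℝ), 0 < c ∧
      ∀ (n w : ℕ) (G : SimpleGraph (Fin n)) [DecidableRel G.Adj] (I M : WordRAM.Memory w),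
        2 ≤ n → G.Connected → K * (n + 1) ≤ 2 ^ w → WordRAM.Represents I G →
          ∃ s : WordRAM.Config P w, P.HaltsIn I M s ∧
            WordRAM.ListsSpanningTree G s.emitEdges ∧
            s.DelayAtMost (C * WordRAM.avgDegree G) ∧
            (c * (n : ℝ) ≤ (s.lazySpace : ℝ) ∧ (s.lazySpace : ℝ) ≤ C * (n : ℝ)) ∧
            (c * (n : ℝ) ≤ (s.space : ℝ) ∧ (s.space : ℝ) ≤ C * (n : ℝ)) := by
  refine ⟨WordRAM.treeProgram, 7, 1, 580, one_pos, fun n w G _ I M hn hG hW hI => ?_⟩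
  obtain ⟨-, hI0, adj, hadj⟩ := hI
  have had : WordRAM.IsAdjacency I G adj :=
    ⟨fun v => (hadj v).1, fun v => (hadj v).2.1, fun v => (hadj v).2.2.1, fun v => (hadj v).2.2.2⟩
  obtain ⟨s, hs, hf⟩ := WordRAM.exists_finished M hn hG hW hI0 had
  have hn' : (2 : ℝ) ≤ n := by exact_mod_cast hn
  have hspace : 1 * (n : ℝ) ≤ ((6 * (n + 1) : ℕ) : ℝ) ∧
      ((6 * (n + 1) : ℕ) : ℝ) ≤ 580 * (n : ℝ) := by
    push_cast
    constructor <;> linarith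
  refine ⟨s, hs, hf.tree, ?_, hf.lazySpace ▸ hspace, hf.space ▸ hspace⟩
  have hdeg : ∀ v, (adj v).length = G.degree v := fun v => by
    rw [← List.toFinset_card_of_nodup (had.nodup v), ← SimpleGraph.card_neighborFinset_eq_degree]
    congr 1
    ext u
    simp [had.mem_iff]
  have : Nontrivial (Fin n) := Fin.nontrivial_iff_two_le.2 hn
  have hone : 1 ≤ WordRAM.avgDegree G := by
    rw [WordRAM.avgDegree, le_div_iff₀ (by linarith), one_mul]
    calc (n : ℝ) = ∑ v : Fin n, (1 : ℝ) := by simp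
      _ ≤ _ := Finset.sum_le_sum fun v _ => by
        exact_mod_cast hG.preconnected.degree_pos_of_nontrivial v
  have hquot : (((∑ x, (adj x).length) / n : ℕ) : ℝ) ≤ WordRAM.avgDegree G := by
    refine Nat.cast_div_le.trans (le_of_eq ?_)
    simp [WordRAM.avgDegree, hdeg]
  refine hf.isChain.imp fun a b hab => ?_
  have hab' : (b : ℝ) ≤ a + (160 * (((∑ x, (adj x).length) / n : ℕ) + 2) + 100) := by
    exact_mod_cast hab
  linarith
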